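/- All graphs are finite and simple. For a graph $H$, the square $H^2$ has the same vertices, two different vertices being adjacent when their distance in $H$ is at most $2$; $H^2\oplus K_1$ is obtained from $H^2$ by adding one vertex adjacent to all others. A split graph is a graph whose vertex set can be partitioned into a clique and an independent set; the $3$-sun consists of an independent set $\{u_1,u_2,u_3\}$ and a clique $\{v_1,v_2,v_3\}$ such that $u_i$ is adjacent to exactly $v_i$ and $v_{i+1}$ (indices modulo $3$). Let $\mathcal G$ be a class of split graphs without induced $3$-sun that is hereditary, i.e. closed under isomorphism and under taking induced subgraphs. Suppose that $\mathcal G$ is simple: there is a function $f$ that assigns to every connected graph $H\in\mathcal G$ a (necessarily connected) graph $f(H)\in\mathcal G$ with $f(H)^2\cong H^2\oplus K_1$ ($f$ need not be computable). If membership in $\mathcal G$ can be decided in polynomial time, then it can be decided in polynomial time whether a given graph $G$ is connected and is the square of a graph in $\mathcal G$, that is, whether $G$ is connected and $G\cong H^2$ for some $H\in\mathcal G$. -/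

import Mathlib

open scoped SimpleGraph

/-- A finite simple graph, with vertex set `{0, …, n - 1}`. -/
structure FinGraph where
  /-- the number of vertices -/
  n : ℕ
  /-- the adjacency structure -/
  graph : SimpleGraph (Fin n)

section GraphNotions

variable {V W : Type*}

/-- The square of a graph: two different vertices are adjacent when their distance is at
most two (vertices in different components have distance `⊤`). -/
def SimpleGraph.square (G : SimpleGraph V) : SimpleGraph V where
  Adj u v := u ≠ v ∧ G.edist u v ≤ 2
  symm := ⟨fun _ _ h => ⟨h.1.symm, by rw [SimpleGraph.edist_comm]; exact h.2⟩⟩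
  loopless := ⟨fun _ h => h.1 rfl⟩

/-- The join of two graphs: the disjoint union together with all edges between the two parts. -/
def SimpleGraph.join (G : SimpleGraph V) (H : SimpleGraph W) : SimpleGraph (V ⊕ W) :=
  (G ⊕g H) ⊔ completeBipartiteGraph V W

/-- A split graph: the vertex set can be partitioned into a clique and an independent set. -/
def SimpleGraph.IsSplitGraph (G : SimpleGraph V) : Prop :=
  ∃ C : Set V, G.IsClique C ∧ G.IsIndepSet Cᶜ

/-- The 3-sun: a stable set `u₀, u₁, u₂` (left summand) and a clique `v₀, v₁, v₂` (right summand),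
where `uᵢ` is adjacent to exactly `vᵢ` and `vᵢ₊₁` (indices modulo 3). -/
def threeSun : SimpleGraph (Fin 3 ⊕ Fin 3) where
  Adj
    | .inl _, .inl _ => False
    | .inl i, .inr j => j = i ∨ j = i + 1
    | .inr j, .inl i => j = i ∨ j = i + 1
    | .inr i, .inr j => i ≠ j
  symm := ⟨by rintro (i | i) (j | j) h <;> first | exact h | exact h.symm⟩
  loopless := ⟨by rintro (i | i) h <;> first | exact h | exact h rfl⟩

/-- A graph without induced 3-sun. -/
def SimpleGraph.IsThreeSunFree (G : SimpleGraph V) : Prop := ¬ threeSun ⊴ G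

end GraphNotions

namespace FinGraph

/-- A class of graphs is hereditary when it contains, with every graph, all (isomorphic copies of)
its induced subgraphs. In particular such a class is closed under isomorphism. -/
def Hereditary (𝒢 : Set FinGraph) : Prop :=
  ∀ G H : FinGraph, G.graph ⊴ H.graph → H ∈ 𝒢 → G ∈ 𝒢

/-- A class `𝒢` is simple when there is a function `f` assigning to every (connected) graph `H`
of the class a graph `f H` of the class with `(f H)² ≅ H² ⊕ K₁`. (Then `f H` is connected too,
as its square is.) -/
def IsSimpleClass (𝒢 : Set FinGraph) : Prop :=
  ∃ f : FinGraph → FinGraph, ∀ H ∈ 𝒢, H.graph.Connected →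
    f H ∈ 𝒢 ∧
      Nonempty ((f H).graph.square ≃g H.graph.square.join (⊤ : SimpleGraph (Fin 1)))

/-- `G` has a square root in the class `𝒢`. -/
def HasSquareRootIn (𝒢 : Set FinGraph) (G : FinGraph) : Prop :=
  ∃ H ∈ 𝒢, Nonempty (G.graph ≃g H.graph.square)

open Classical in
/-- The input word of a graph: its adjacency matrix, written row by row, each row being
terminated by the separator `none`. Its length is `n * (n + 1)`. -/
noncomputable def encode (G : FinGraph) : List (Option Bool) :=
  (List.finRange G.n).flatMap fun i =>
    ((List.finRange G.n).map fun j => some (decide (G.graph.Adj i j))) ++ [none]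

/-- A set of graphs is recognizable in polynomial time when its indicator function is computed
by a (multi-stack) Turing machine, on every graph given by its adjacency matrix, in a number of
steps that is bounded by a polynomial in the length of the input. -/
def PolyTimeRecognizable (𝒢 : Set FinGraph) : Prop :=
  ∃ f : FinGraph → Bool, (∀ G, f G = true ↔ G ∈ 𝒢) ∧
    Nonempty (Turing.TM2ComputableInPolyTime encode Computability.encodeBool f)

end FinGraph

/-! Write N[c] for a closed neighbourhood, and call vertices near when they are equal or adjacent. A
connected split graph H has a dominating clique C with independent complement, and two vertices are
near in H² exactly when some N[c] with c in C contains both (`near_square_iff`). Three of these sets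
overlapping in a triangle would give an induced 3-sun, so they have the Helly property
(`IsThreeSunFree.not_triangle`, `exists_cover_of_pairs`).

Therefore enough of H can be read off from G = H². If the common closed neighbourhood of two near
vertices of G is a clique, it is one of the N[c]; and any two near vertices lie in a clique
generated in this way (`covered_square`). The vertices of C are universal in G. Hence the skeleton
of G, with a clique of hubs for the generated cliques and an independent set of leaves for the
non-universal vertices, joined by incidence, is an induced subgraph of H
(`skeleton_isIndContained`), and it belongs to the class by heredity.

Conversely, whenever the generated cliques cover all near pairs of G, the square of the skeleton is
G up to the number of universal vertices (`Covered.matches_skeleton`). If the skeleton is in the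
class and not larger than G, the function f supplies the missing universal vertices one at a time
(`exists_square_of_matches`). This gives a many-one reduction to membership in the class
(`reduce_mem_iff`); f occurs only in its correctness proof and is never computed.

The reduction takes polynomial time because the skeleton lives on pairs of vertices of G and is
first-order definable from adjacency and the order of the vertices. A fixed formula is evaluated by
nested loops (`Fml.exec_prog`), a graph defined by formulas can be written down (`exec_interpret`),
structured programs compile to machine code (`Exec.code`), and `polyTime_comp` puts the result in
front of the machine that decides the class. -/

/-! ### Structured stack programs and their machine code. -/

/-- Structured programs over stacks indexed by `K` with symbols from `S`, and one Boolean flag. -/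
inductive StackProg (K S : Type) : Type
  /-- do nothing -/
  | skip : StackProg K S
  /-- push a symbol -/
  | push (k : K) (a : S) : StackProg K S
  /-- set the flag -/
  | setFlag (b : Bool) : StackProg K S
  /-- sequential composition -/
  | seq (c d : StackProg K S) : StackProg K S
  /-- branch on the flag -/
  | ite (c d : StackProg K S) : StackProg K S
  /-- if the stack is nonempty, pop it and continue depending on the symbol -/
  | pop (k : K) (c : S → StackProg K S) : StackProg K S
  /-- as long as the stack is nonempty, pop it and continue depending on the symbol -/
  | loop (k : K) (c : S → StackProg K S) : StackProg K S

namespace StackProg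

variable {K S : Type}

/-- The memory of a structured program. -/
structure Store (K S : Type) where
  /-- the flag -/
  flag : Bool
  /-- the contents of the stacks -/
  stk : K → List S

variable [DecidableEq K]

/-- Big-step semantics: `Exec c s s' t` says that `c` transforms `s` into `s'` within time `t`. -/
inductive Exec : StackProg K S → Store K S → Store K S → ℕ → Prop
  | skip (s) : Exec skip s s 1
  | push (k a f stk) :
      Exec (push k a) ⟨f, stk⟩ ⟨f, Function.update stk k (a :: stk k)⟩ 1
  | setFlag (b f stk) : Exec (setFlag b) ⟨f, stk⟩ ⟨b, stk⟩ 1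
  | seq {c d s s' s'' t t'} : Exec c s s' t → Exec d s' s'' t' → Exec (seq c d) s s'' (t + t')
  | ite_true {c d stk s' t} : Exec c ⟨true, stk⟩ s' t → Exec (ite c d) ⟨true, stk⟩ s' (t + 1)
  | ite_false {c d stk s' t} : Exec d ⟨false, stk⟩ s' t → Exec (ite c d) ⟨false, stk⟩ s' (t + 1)
  | pop_nil {k c s} : s.stk k = [] → Exec (pop k c) s s 1
  | pop_cons {k c f stk a l s' t} : stk k = a :: l →
      Exec (c a) ⟨f, Function.update stk k l⟩ s' t → Exec (pop k c) ⟨f, stk⟩ s' (t + 1)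
  | loop_nil {k c s} : s.stk k = [] → Exec (loop k c) s s 1
  | loop_cons {k c f stk a l s' s'' t t'} : stk k = a :: l →
      Exec (c a) ⟨f, Function.update stk k l⟩ s' t → Exec (loop k c) s' s'' t' →
      Exec (loop k c) ⟨f, stk⟩ s'' (t + t' + 1)
  | mono {c s s' t t'} : Exec c s s' t → t ≤ t' → Exec c s s' t'

/-- The labels of the machine code of a structured program. -/
@[reducible]
def Label : StackProg K S → Type
  | skip => Unit
  | push _ _ => Unit
  | setFlag _ => Unit
  | seq c d => Label c ⊕ Label d
  | ite c d => Option (Label c ⊕ Label d)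
  | pop _ c => Option (Σ a, Label (c a))
  | loop _ c => Option (Σ a, Label (c a))

omit [DecidableEq K] in
theorem finite_label [Finite S] : ∀ c : StackProg K S, Finite (Label c)
  | skip => inferInstanceAs (Finite Unit)
  | push _ _ => inferInstanceAs (Finite Unit)
  | setFlag _ => inferInstanceAs (Finite Unit)
  | seq c d =>
    have := finite_label c
    have := finite_label d
    inferInstanceAs (Finite (Label c ⊕ Label d))
  | ite c d =>
    have := finite_label c
    have := finite_label d
    inferInstanceAs (Finite (Option (Label c ⊕ Label d)))
  | pop _ c =>
    have := fun a => finite_label (c a)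
    inferInstanceAs (Finite (Option (Σ a, Label (c a))))
  | loop _ c =>
    have := fun a => finite_label (c a)
    inferInstanceAs (Finite (Option (Σ a, Label (c a))))

/-- The label at which the machine code of a structured program starts. -/
def entry : (c : StackProg K S) → Label c
  | skip => ()
  | push _ _ => ()
  | setFlag _ => ()
  | seq c _ => Sum.inl (entry c)
  | ite _ _ => none
  | pop _ _ => none
  | loop _ _ => none

section Compile

variable {K₀ : Type} {Γ₀ : K₀ → Type} {σ₀ Λ : Type}

/-- The stack alphabets of a machine with additional stacks for a structured program. -/
@[reducible]
def Alphabet (K S : Type) {K₀ : Type} (Γ₀ : K₀ → Type) : K₀ ⊕ K → Type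
  | Sum.inl k => Γ₀ k
  | Sum.inr _ => S

/-- The stacks of a machine with additional stacks for a structured program. -/
def joinStk (stk₀ : ∀ k, List (Γ₀ k)) (stk : K → List S) : ∀ k, List (Alphabet K S Γ₀ k)
  | Sum.inl k => stk₀ k
  | Sum.inr k => stk k

/-- The machine code of a structured program, with labels embedded by `emb`; it continues at the
label `next`. -/
def code : (c : StackProg K S) → (Label c → Λ) → Λ → Label c →
    Turing.TM2.Stmt (Alphabet K S Γ₀) Λ (σ₀ × Bool × Option S)
  | skip, _, next, _ => .goto fun _ => next
  | push k a, _, next, _ => .push (Sum.inr k) (fun _ => a) (.goto fun _ => next)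
  | setFlag b, _, next, _ => .load (fun v => (v.1, b, v.2.2)) (.goto fun _ => next)
  | seq _ d, emb, _, Sum.inl l =>
    code _ (fun l => emb (Sum.inl l)) (emb (Sum.inr (entry d))) l
  | seq _ _, emb, next, Sum.inr l => code _ (fun l => emb (Sum.inr l)) next l
  | ite c d, emb, _, none =>
    .goto fun v => if v.2.1 then emb (some (Sum.inl (entry c))) else emb (some (Sum.inr (entry d)))
  | ite _ _, emb, next, some (Sum.inl l) => code _ (fun l => emb (some (Sum.inl l))) next l
  | ite _ _, emb, next, some (Sum.inr l) => code _ (fun l => emb (some (Sum.inr l))) next l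
  | pop k c, emb, next, none =>
    .pop (Sum.inr k) (fun v o => (v.1, v.2.1, o)) (.goto fun v =>
      v.2.2.elim next fun a => emb (some ⟨a, entry (c a)⟩))
  | pop _ _, emb, next, some ⟨a, l⟩ => code _ (fun l => emb (some ⟨a, l⟩)) next l
  | loop k c, emb, next, none =>
    .pop (Sum.inr k) (fun v o => (v.1, v.2.1, o)) (.goto fun v =>
      v.2.2.elim next fun a => emb (some ⟨a, entry (c a)⟩))
  -- The only difference from `pop`: the body returns to the test instead of leaving.
  | loop _ _, emb, _, some ⟨a, l⟩ => code _ (fun l => emb (some ⟨a, l⟩)) (emb none) l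

omit [DecidableEq K] in
theorem joinStk_inr (stk₀ : ∀ k, List (Γ₀ k)) (stk : K → List S) (k : K) :
    joinStk stk₀ stk (Sum.inr k) = stk k := rfl

theorem joinStk_update_inr [DecidableEq K₀] (stk₀ : ∀ k, List (Γ₀ k)) (stk : K → List S) (k : K)
    (l : List S) :
    Function.update (joinStk stk₀ stk) (Sum.inr k) l
      = joinStk stk₀ (Function.update stk k l) := by
  funext k'
  rcases k' with k' | k'
  · rw [Function.update_of_ne (by simp)]; rfl
  · by_cases h : k' = k
    · subst h
      rw [Function.update_self, joinStk_inr, Function.update_self]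
    · rw [Function.update_of_ne (by simpa using h), joinStk_inr, joinStk_inr,
        Function.update_of_ne h]

theorem joinStk_update_inl [DecidableEq K₀] (stk₀ : ∀ k, List (Γ₀ k)) (stk : K → List S) (k : K₀)
    (l : List (Γ₀ k)) :
    Function.update (joinStk stk₀ stk) (Sum.inl k) l
      = joinStk (Function.update stk₀ k l) stk := by
  funext k'
  rcases k' with k' | k'
  · by_cases h : k' = k
    · subst h
      simp [joinStk]
    · rw [Function.update_of_ne (by simpa using h)]
      simp [joinStk, h]
  · rw [Function.update_of_ne (by simp)]; rfl

/-- `f` leads from `a` to `b` in exactly `n` steps. -/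
def StepsTo {α : Type*} (f : α → Option α) (n : ℕ) (a b : α) : Prop :=
  (flip bind f)^[n] (some a) = some b

theorem StepsTo.single {α : Type*} {f : α → Option α} {a b : α} (h : f a = some b) :
    StepsTo f 1 a b := h

theorem StepsTo.of_eq {α : Type*} {f : α → Option α} {n : ℕ} {a b a' b' : α}
    (h : StepsTo f n a b) (ha : a' = a) (hb : b' = b) : StepsTo f n a' b' := by
  rwa [ha, hb]

theorem StepsTo.trans {α : Type*} {f : α → Option α} {m n : ℕ} {a b c : α}
    (h : StepsTo f m a b) (h' : StepsTo f n b c) : StepsTo f (m + n) a c := by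
  unfold StepsTo at *
  rw [add_comm, Function.iterate_add_apply, h, h']

/-- The machine code of a structured program simulates its big-step semantics. -/
theorem Exec.code [DecidableEq K₀] {M : Λ → Turing.TM2.Stmt (Alphabet K S Γ₀) Λ (σ₀ × Bool × Option S)}
    (v₀ : σ₀) (stk₀ : ∀ k, List (Γ₀ k)) {c : StackProg K S} {s s' : Store K S} {t : ℕ}
    (h : Exec c s s' t) : ∀ (emb : Label c → Λ) (next : Λ) (r : Option S),
      (∀ l, M (emb l) = code c emb next l) →
      ∃ n ≤ t, ∃ r', StepsTo (Turing.TM2.step M) n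
        ⟨some (emb (entry c)), (v₀, s.flag, r), joinStk stk₀ s.stk⟩
        ⟨some next, (v₀, s'.flag, r'), joinStk stk₀ s'.stk⟩ := by
  -- The embedding, the continuation and the last popped symbol stay quantified, because subprograms
  -- sit at other labels, continue elsewhere and start with whatever was popped before.
  induction h with
  | skip s =>
    intro emb next r hM
    refine ⟨1, le_rfl, r, .single ?_⟩
    simp [hM, StackProg.code]
  | push k a f stk =>
    intro emb next r hM
    refine ⟨1, le_rfl, r, .single ?_⟩
    simp only [Turing.TM2.step, hM, StackProg.code, Turing.TM2.stepAux, joinStk_inr]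
    rw [joinStk_update_inr]
  | setFlag b f stk =>
    intro emb next r hM
    refine ⟨1, le_rfl, r, .single ?_⟩
    simp [hM, StackProg.code]
  | seq _ _ ih ih' =>
    intro emb next r hM
    obtain ⟨n, hn, r', h1⟩ := ih (fun l => emb (Sum.inl l)) (emb (Sum.inr (entry _))) r
      (fun l => hM (Sum.inl l))
    obtain ⟨n', hn', r'', h2⟩ := ih' (fun l => emb (Sum.inr l)) next r' (fun l => hM (Sum.inr l))
    exact ⟨n + n', by omega, r'', h1.trans h2⟩
  | ite_true _ ih =>
    intro emb next r hM
    obtain ⟨n, hn, r', h1⟩ := ih (fun l => emb (some (Sum.inl l))) next r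
      (fun l => hM (some (Sum.inl l)))
    refine ⟨1 + n, by omega, r', StepsTo.trans (.single ?_) h1⟩
    simp [entry, hM, StackProg.code]
  | ite_false _ ih =>
    intro emb next r hM
    obtain ⟨n, hn, r', h1⟩ := ih (fun l => emb (some (Sum.inr l))) next r
      (fun l => hM (some (Sum.inr l)))
    refine ⟨1 + n, by omega, r', StepsTo.trans (.single ?_) h1⟩
    simp [entry, hM, StackProg.code]
  | pop_nil h =>
    intro emb next r hM
    refine ⟨1, le_rfl, none, .single ?_⟩
    simp only [entry, Turing.TM2.step, hM, StackProg.code, Turing.TM2.stepAux, joinStk_inr, h]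
    rw [joinStk_update_inr, List.tail_nil, Function.update_eq_self_iff.2 h.symm]
    rfl
  | @pop_cons k c f stk a l s' t h _ ih =>
    intro emb next r hM
    obtain ⟨n, hn, r', h1⟩ := ih (fun l => emb (some ⟨a, l⟩)) next (some a)
      (fun l => hM (some ⟨a, l⟩))
    refine ⟨1 + n, by omega, r', StepsTo.trans (.single ?_) h1⟩
    simp only [entry, Turing.TM2.step, hM, StackProg.code, Turing.TM2.stepAux, joinStk_inr, h]
    rw [joinStk_update_inr, List.tail_cons]
    rfl
  | loop_nil h =>
    intro emb next r hM
    refine ⟨1, le_rfl, none, .single ?_⟩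
    simp only [entry, Turing.TM2.step, hM, StackProg.code, Turing.TM2.stepAux, joinStk_inr, h]
    rw [joinStk_update_inr, List.tail_nil, Function.update_eq_self_iff.2 h.symm]
    rfl
  | @loop_cons k c f stk a l s' s'' t t' h _ _ ih ih' =>
    intro emb next r hM
    obtain ⟨n, hn, r', h1⟩ := ih (fun l => emb (some ⟨a, l⟩)) (emb none) (some a)
      (fun l => hM (some ⟨a, l⟩))
    obtain ⟨n', hn', r'', h2⟩ := ih' emb next r' hM
    refine ⟨1 + n + n', by omega, r'', StepsTo.trans (StepsTo.trans (.single ?_) h1) h2⟩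
    simp only [entry, Turing.TM2.step, hM, StackProg.code, Turing.TM2.stepAux, joinStk_inr, h]
    rw [joinStk_update_inr, List.tail_cons]
    rfl
  | mono _ hle ih =>
    intro emb next r hM
    obtain ⟨n, hn, r', h1⟩ := ih emb next r hM
    exact ⟨n, hn.trans hle, r', h1⟩

end Compile

/-! ### Running a structured program in front of a machine. -/

section Prepend

open Turing

/-- A statement of a machine, as a statement of a machine with additional stacks, labels and
registers. -/
def liftStmt {K₀ : Type} {Γ₀ : K₀ → Type} {σ₀ Λ Λ' ρ : Type} :
    TM2.Stmt Γ₀ Λ σ₀ → TM2.Stmt (Alphabet K S Γ₀) (Λ ⊕ Λ') (σ₀ × ρ)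
  | .push k f q => .push (Sum.inl k) (fun v => f v.1) (liftStmt q)
  | .peek k f q => .peek (Sum.inl k) (fun v o => (f v.1 o, v.2)) (liftStmt q)
  | .pop k f q => .pop (Sum.inl k) (fun v o => (f v.1 o, v.2)) (liftStmt q)
  | .load f q => .load (fun v => (f v.1, v.2)) (liftStmt q)
  | .branch p q q' => .branch (fun v => p v.1) (liftStmt q) (liftStmt q')
  | .goto l => .goto fun v => Sum.inl (l v.1)
  | .halt => .halt

/-- A configuration of a machine, as a configuration of a machine with additional stacks, labels
and registers. -/
def liftCfg {K₀ : Type} {Γ₀ : K₀ → Type} {σ₀ Λ Λ' ρ : Type} (v : ρ) (stk : K → List S)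
    (x : TM2.Cfg Γ₀ Λ σ₀) : TM2.Cfg (Alphabet K S Γ₀) (Λ ⊕ Λ') (σ₀ × ρ) :=
  ⟨x.l.map Sum.inl, (x.var, v), joinStk x.stk stk⟩

/-- A lifted statement touches only the old registers and stacks, so the additional ones are carried
along unchanged. -/
theorem stepAux_liftStmt {K₀ : Type} [DecidableEq K₀] {Γ₀ : K₀ → Type} {σ₀ Λ Λ' ρ : Type} (v : ρ)
    (stk : K → List S) (q : TM2.Stmt Γ₀ Λ σ₀) (v₀ : σ₀) (stk₀ : ∀ k, List (Γ₀ k)) :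
    TM2.stepAux (liftStmt (Λ' := Λ') q) (v₀, v) (joinStk stk₀ stk)
      = liftCfg v stk (TM2.stepAux q v₀ stk₀) := by
  induction q generalizing v₀ stk₀ with
  | push k f q ih =>
    simp only [liftStmt, TM2.stepAux]
    rw [← ih, ← joinStk_update_inl]
    rfl
  | peek k f q ih =>
    simp only [liftStmt, TM2.stepAux]
    rw [← ih]
    rfl
  | pop k f q ih =>
    simp only [liftStmt, TM2.stepAux]
    rw [← ih, ← joinStk_update_inl]
    rfl
  | load f q ih =>
    simp only [liftStmt, TM2.stepAux]
    rw [← ih]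
  | branch p q q' ih ih' =>
    simp only [liftStmt, TM2.stepAux]
    cases p v₀
    · exact ih' _ _
    · exact ih _ _
  | goto l => rfl
  | halt => rfl

theorem StepsTo.lift {K₀ : Type} [DecidableEq K₀] {Γ₀ : K₀ → Type} {σ₀ Λ Λ' ρ : Type} (v : ρ)
    (stk : K → List S) {m : Λ → TM2.Stmt Γ₀ Λ σ₀}
    {M : Λ ⊕ Λ' → TM2.Stmt (Alphabet K S Γ₀) (Λ ⊕ Λ') (σ₀ × ρ)}
    (hM : ∀ l, M (Sum.inl l) = liftStmt (m l)) {n : ℕ} {x y : TM2.Cfg Γ₀ Λ σ₀}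
    (h : StepsTo (TM2.step m) n x y) :
    StepsTo (TM2.step M) n (liftCfg v stk x) (liftCfg v stk y) := by
  induction n generalizing x with
  | zero =>
    have : x = y := by simpa [StepsTo] using h
    subst this
    rfl
  | succ n ih =>
    have key : ∀ z, TM2.step m x = some z →
        TM2.step M (liftCfg v stk x) = some (liftCfg v stk z) := by
      intro z hz
      obtain ⟨l, w, s⟩ := x
      cases l with
      | none => simp at hz
      | some l =>
        simp only [TM2.step, Option.some.injEq] at hz
        simp only [liftCfg, Option.map_some, TM2.step, hM, Option.some.injEq]
        rw [stepAux_liftStmt, hz]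
        rfl
    unfold StepsTo at h ⊢
    rw [Function.iterate_succ_apply] at h ⊢
    cases hz : TM2.step m x with
    | none =>
      -- A run that has stopped stays `none`, so it cannot arrive at `some y`.
      have h0 : ∀ k, (flip bind (TM2.step m))^[k] none = none := by
        intro k
        induction k with
        | zero => rfl
        | succ k ih => rw [Function.iterate_succ_apply]; exact ih
      have : flip bind (TM2.step m) (some x) = none := hz
      rw [this, h0] at h
      cases h
    | some z =>
      have h1 : flip bind (TM2.step m) (some x) = some z := hz
      have h2 : flip bind (TM2.step M) (some (liftCfg v stk x)) = some (liftCfg v stk z) :=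
        key z hz
      rw [h1] at h
      rw [h2]
      exact ih h

variable (tm : FinTM2) (c : StackProg K S) (out : K) (sym : S → tm.Γ tm.k₀)

/-- The program that runs `c`, moves the stack `out` to the input stack of `tm`, and runs `tm`. -/
def prependCode [Inhabited S] : tm.Λ ⊕ (Label c ⊕ Unit) →
    TM2.Stmt (Alphabet K S tm.Γ) (tm.Λ ⊕ (Label c ⊕ Unit)) (tm.σ × Bool × Option S)
  | Sum.inl l => liftStmt (tm.m l)
  | Sum.inr (Sum.inl l) =>
    code c (fun l => Sum.inr (Sum.inl l)) (Sum.inr (Sum.inr ())) l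
  | Sum.inr (Sum.inr _) =>
    -- The flag is reset here and the last pop stores `none`: a halting configuration must have the
    -- initial register values.
    .pop (Sum.inr out) (fun v o => (v.1, false, o)) (.branch (fun v => v.2.2.isSome)
      -- The default symbol is never pushed, since this branch is taken only after a successful pop.
      (.push (Sum.inl tm.k₀) (fun v => sym (v.2.2.getD default))
        (.goto fun _ => Sum.inr (Sum.inr ())))
      (.goto fun _ => Sum.inl tm.main))

/-- Moving a stack symbol by symbol reverses it, so programs have to leave their output reversed.
The other stacks must already be empty, as they have to be when the whole machine halts. -/
theorem prependCode_copy [Inhabited S] (v₀ : tm.σ) (stk : K → List S)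
    (hstk : ∀ k, k ≠ out → stk k = []) (w : List S) (hw : stk out = w) (f : Bool) (r : Option S)
    (stk₀ : ∀ k, List (tm.Γ k)) :
    StepsTo (TM2.step (prependCode tm c out sym)) (w.length + 1)
      ⟨some (Sum.inr (Sum.inr ())), (v₀, f, r), joinStk stk₀ stk⟩
      ⟨some (Sum.inl tm.main), (v₀, false, none),
        joinStk (Function.update stk₀ tm.k₀ ((w.map sym).reverse ++ stk₀ tm.k₀)) fun _ => []⟩ := by
  induction w generalizing f r stk₀ stk with
  | nil =>
    have : stk = fun _ => [] := by
      funext k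
      by_cases h : k = out
      · rw [h, hw]
      · exact hstk k h
    refine StepsTo.single ?_
    simp only [TM2.step, prependCode, TM2.stepAux, joinStk_inr, hw]
    rw [joinStk_update_inr]
    simp only [List.head?_nil, Option.isSome_none, cond_false, List.tail_nil, Option.some.injEq]
    rw [← hw, Function.update_eq_self, this]
    simp
  | cons a w ih =>
    have h1 : StepsTo (TM2.step (prependCode tm c out sym)) 1
        ⟨some (Sum.inr (Sum.inr ())), (v₀, f, r), joinStk stk₀ stk⟩
        ⟨some (Sum.inr (Sum.inr ())), (v₀, false, some a),
          joinStk (Function.update stk₀ tm.k₀ (sym a :: stk₀ tm.k₀))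
            (Function.update stk out w)⟩ := by
      refine StepsTo.single ?_
      simp only [TM2.step, prependCode, TM2.stepAux, joinStk_inr, hw]
      rw [joinStk_update_inr, joinStk_update_inl]
      rfl
    have h2 := ih (Function.update stk out w)
      (fun k hk => by rw [Function.update_of_ne hk, hstk k hk]) (by simp) false (some a)
      (Function.update stk₀ tm.k₀ (sym a :: stk₀ tm.k₀))
    have h3 := h1.trans h2
    rw [Function.update_idem, Function.update_self, Nat.add_comm] at h3
    simpa using h3

/-- The machine that runs `c`, moves the stack `out` to the input stack of `tm`, and runs `tm`. -/
noncomputable def prepend [Fintype K] [Fintype S] [Inhabited S] (inp : K) : FinTM2 where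
  K := tm.K ⊕ K
  kDecidableEq := inferInstance
  kFin := haveI := tm.kFin; inferInstance
  k₀ := Sum.inr inp
  k₁ := Sum.inl tm.k₁
  Γ := Alphabet K S tm.Γ
  Λ := tm.Λ ⊕ (Label c ⊕ Unit)
  main := Sum.inr (Sum.inl (entry c))
  ΛFin := haveI := tm.ΛFin; haveI := finite_label c; Fintype.ofFinite _
  σ := tm.σ × Bool × Option S
  initialState := (tm.initialState, false, none)
  σFin := haveI := tm.σFin; inferInstance
  Γk₀Fin := inferInstanceAs (Fintype S)
  m := prependCode tm c out sym

end Prepend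

open Turing in
theorem initList_eq (tm : FinTM2) (s : List (tm.Γ tm.k₀)) :
    initList tm s = ⟨some tm.main, tm.initialState, Function.update (fun _ => []) tm.k₀ s⟩ := by
  unfold initList
  congr 1
  funext k
  by_cases h : k = tm.k₀
  · subst h
    simp
  · simp [h]

open Turing in
theorem haltList_eq (tm : FinTM2) (s : List (tm.Γ tm.k₁)) :
    haltList tm s = ⟨none, tm.initialState, Function.update (fun _ => []) tm.k₁ s⟩ := by
  unfold haltList
  congr 1
  funext k
  by_cases h : k = tm.k₁
  · subst h
    simp
  · simp [h]

omit [DecidableEq K] in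
theorem joinStk_nil {K₀ : Type} {Γ₀ : K₀ → Type} :
    joinStk (fun k => ([] : List (Γ₀ k))) (fun _ : K => ([] : List S)) = fun _ => [] := by
  funext k
  cases k <;> rfl

open Turing in
theorem initList_prepend [Fintype K] [Fintype S] [Inhabited S] (tm : FinTM2) (c : StackProg K S)
    (out : K) (sym : S → tm.Γ tm.k₀) (inp : K) (s : List S) :
    initList (prepend tm c out sym inp) s
      = ⟨some (Sum.inr (Sum.inl (entry c))), (tm.initialState, false, none),
          joinStk (fun _ => []) (Function.update (fun _ => []) inp s)⟩ := by
  refine (initList_eq _ _).trans (congrArg (TM2.Cfg.mk _ _) ?_)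
  rw [← joinStk_update_inr, joinStk_nil]
  rfl

open Turing in
theorem haltList_prepend [Fintype K] [Fintype S] [Inhabited S] (tm : FinTM2) (c : StackProg K S)
    (out : K) (sym : S → tm.Γ tm.k₀) (inp : K) (s : List (tm.Γ tm.k₁)) :
    haltList (prepend tm c out sym inp) s
      = ⟨none, (tm.initialState, false, none),
          joinStk (Function.update (fun _ => []) tm.k₁ s) fun _ => []⟩ := by
  refine (haltList_eq _ _).trans (congrArg (TM2.Cfg.mk _ _) ?_)
  rw [← joinStk_update_inl, joinStk_nil]
  rfl

/-- Natural coefficients are nonnegative. This allows a time bound in one size to be evaluated at a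
larger size. -/
theorem _root_.Polynomial.eval_nat_mono (p : Polynomial ℕ) : Monotone fun n => p.eval n := by
  intro m n h
  simp only [Polynomial.eval_eq_sum_range]
  gcongr

open Turing in
/-- A function computed by a structured program in polynomial time may be composed with a function
computed by a machine in polynomial time. -/
theorem polyTime_comp [Fintype K] [Fintype S] [Inhabited S] {α β γ Γ₁ : Type} {ea : α → List S}
    {eb : β → List S} {ec : γ → List Γ₁} {g : β → γ} (hg : TM2ComputableInPolyTime eb ec g)
    (r : α → β) (c : StackProg K S) (inp out : K) (p q : Polynomial ℕ)
    (hc : ∀ a, ∃ f, Exec c ⟨false, Function.update (fun _ => []) inp (ea a)⟩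
      ⟨f, Function.update (fun _ => []) out (eb (r a)).reverse⟩ (p.eval (ea a).length))
    (hq : ∀ a, (eb (r a)).length ≤ q.eval (ea a).length) :
    Nonempty (TM2ComputableInPolyTime ea ec (g ∘ r)) := by
  let tm := hg.tm
  let sym : S → tm.Γ tm.k₀ := hg.inputAlphabet.invFun
  let T := prepend tm c out sym inp
  -- The three summands pay for the program, for copying its output with one final test, and for the
  -- second machine on an input of length at most `q`.
  refine ⟨⟨⟨T, Equiv.refl S, hg.outputAlphabet⟩, p + (q + 1) + hg.time.comp q, fun a => ?_⟩⟩
  suffices h : ∃ n ≤ (p + (q + 1) + hg.time.comp q).eval (ea a).length,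
      StepsTo (TM2.step T.m) n (initList T (ea a))
        (haltList T (List.map hg.outputAlphabet.invFun (ec (g (r a))))) by
    have hn := h.choose_spec
    refine ⟨⟨h.choose, ?_⟩, hn.1⟩
    exact (congrArg (fun w => (flip bind T.step)^[h.choose] (some (Turing.initList T w)))
      (List.map_id (ea a))).trans hn.2
  obtain ⟨f, hf⟩ := hc a
  obtain ⟨n, hn, s, h1⟩ := hf.code (M := T.m) tm.initialState (fun _ => [])
    (fun l => Sum.inr (Sum.inl l)) (Sum.inr (Sum.inr ())) none (fun l => rfl)
  have h2 := prependCode_copy tm c out sym tm.initialState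
    (Function.update (fun _ => []) out (eb (r a)).reverse)
    (fun k hk => by rw [Function.update_of_ne hk]) _ (Function.update_self ..) f s (fun _ => [])
  obtain ⟨⟨m, hm⟩, hle⟩ := hg.outputsFun (r a)
  have h3 : StepsTo (TM2.step tm.m) m
      (initList tm (List.map sym (eb (r a))))
      (haltList tm (List.map hg.outputAlphabet.invFun (ec (g (r a))))) := hm
  have h4 := h3.lift (Λ' := Label c ⊕ Unit) (false, (none : Option S)) (fun _ : K => [])
    (M := T.m) (fun l => rfl)
  refine ⟨n + ((eb (r a)).reverse.length + 1) + m, ?_, ?_⟩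
  · have := hg.time.eval_nat_mono (hq a)
    have h6 := hq a
    simp only [Polynomial.eval_add, Polynomial.eval_comp, Polynomial.eval_one,
      List.length_reverse] at *
    omega
  · rw [initList_eq, haltList_eq] at h4
    simp only [List.map_reverse, List.reverse_reverse, List.append_nil] at h2
    exact StepsTo.of_eq ((h1.trans h2).trans h4) (initList_prepend tm c out sym inp _)
      (haltList_prepend tm c out sym inp _)

end StackProg

/-! ### Arithmetic with unary counters and loops with invariants. -/

/-- The stacks of the evaluation programs that hold words. -/
inductive Tape
  /-- the input matrix -/
  | mat
  /-- a buffer for the part of the matrix already read -/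
  | buf
  /-- the output -/
  | out
  deriving DecidableEq

instance : Fintype Tape := ⟨{.mat, .buf, .out}, by rintro (_ | _ | _) <;> simp⟩

/-- The stacks of the evaluation programs that hold numbers, in unary. -/
inductive Ctr
  /-- a number that is counted up -/
  | cnt
  /-- the number of vertices -/
  | len
  /-- a copy of `len` -/
  | len'
  /-- scratch space -/
  | tmp
  /-- scratch space -/
  | tmp'
  /-- the value of a vertex variable -/
  | lo (v : Fin 8)
  /-- the number of vertices above the value of a vertex variable -/
  | hi (v : Fin 8)
  deriving DecidableEq, Fintype

namespace StackProg

/-- Programs for the evaluation of formulas. -/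
abbrev Prog := StackProg (Tape ⊕ Ctr) (Option Bool)

/-- A memory, given by the flag, the words and the numbers that are stored. -/
def store (f : Bool) (t : Tape → List (Option Bool)) (n : Ctr → ℕ) :
    Store (Tape ⊕ Ctr) (Option Bool) :=
  ⟨f, Sum.elim t fun c => List.replicate (n c) none⟩

/-- Increment a counter. -/
def inc (c : Ctr) : Prog := push (Sum.inr c) none

/-- Write a symbol on a tape. -/
def write (τ : Tape) (a : Option Bool) : Prog := push (Sum.inl τ) a

/-- If a counter is positive, decrement it and run the program. -/
def popCtr (c : Ctr) (p : Prog) : Prog := pop (Sum.inr c) fun _ => p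

/-- As long as a counter is positive, decrement it and run the program. -/
def loopCtr (c : Ctr) (p : Prog) : Prog := loop (Sum.inr c) fun _ => p

variable {f : Bool} {t : Tape → List (Option Bool)} {n : Ctr → ℕ}

theorem Exec.of_eq {K S : Type} [DecidableEq K] {p : StackProg K S} {s s' r r' : Store K S}
    {m : ℕ} (h : Exec p s s' m) (h1 : r = s) (h2 : s' = r') : Exec p r r' m := by
  rwa [h1, ← h2]

theorem store_stk_inl (τ : Tape) : (store f t n).stk (Sum.inl τ) = t τ := rfl

theorem store_stk_inr (c : Ctr) :
    (store f t n).stk (Sum.inr c) = List.replicate (n c) none := rfl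

theorem update_store_inr (c : Ctr) (k : ℕ) :
    Function.update (store f t n).stk (Sum.inr c) (List.replicate k none)
      = (store f t (Function.update n c k)).stk := by
  funext x
  rcases x with x | x
  · rw [Function.update_of_ne (by simp)]; rfl
  · by_cases h : x = c
    · subst h; rw [Function.update_self, store_stk_inr, Function.update_self]
    · rw [Function.update_of_ne (by simpa using h), store_stk_inr, store_stk_inr,
        Function.update_of_ne h]

theorem update_store_inl (τ : Tape) (w : List (Option Bool)) :
    Function.update (store f t n).stk (Sum.inl τ) w
      = (store f (Function.update t τ w) n).stk := by
  funext x
  rcases x with x | x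
  · by_cases h : x = τ
    · subst h; rw [Function.update_self, store_stk_inl, Function.update_self]
    · rw [Function.update_of_ne (by simpa using h), store_stk_inl, store_stk_inl,
        Function.update_of_ne h]
  · rw [Function.update_of_ne (by simp)]; rfl

theorem exec_inc (c : Ctr) :
    Exec (inc c) (store f t n) (store f t (Function.update n c (n c + 1))) 1 := by
  refine (Exec.push (Sum.inr c) none f (store f t n).stk).of_eq rfl ?_
  have : none :: (store f t n).stk (Sum.inr c) = List.replicate (n c + 1) none := rfl
  rw [this, update_store_inr]
  rfl

theorem exec_write (τ : Tape) (a : Option Bool) :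
    Exec (write τ a) (store f t n) (store f (Function.update t τ (a :: t τ)) n) 1 := by
  refine (Exec.push (Sum.inl τ) a f (store f t n).stk).of_eq rfl ?_
  have : a :: (store f t n).stk (Sum.inl τ) = a :: t τ := rfl
  rw [this, update_store_inl]
  rfl

theorem exec_setFlag (b : Bool) : Exec (setFlag b) (store f t n) (store b t n) 1 :=
  Exec.setFlag _ _ _

theorem exec_popCtr_zero {c : Ctr} {p : Prog} (h : n c = 0) :
    Exec (popCtr c p) (store f t n) (store f t n) 1 :=
  Exec.pop_nil (by simp [store, h])

theorem exec_popCtr_succ {c : Ctr} {p : Prog} {k m : ℕ} {s : Store (Tape ⊕ Ctr) (Option Bool)}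
    (h : n c = k + 1) (hp : Exec p (store f t (Function.update n c k)) s m) :
    Exec (popCtr c p) (store f t n) s (m + 1) := by
  refine Exec.pop_cons (a := none) (l := List.replicate k none) (by exact congrArg (List.replicate · none) h) ?_
  exact hp.of_eq (congrArg (Store.mk f) (update_store_inr (f := f) c k)) rfl

theorem exec_popTape_cons {τ : Tape} {p : Option Bool → Prog} {a : Option Bool}
    {w : List (Option Bool)} {m : ℕ} {s : Store (Tape ⊕ Ctr) (Option Bool)}
    (h : t τ = a :: w) (hp : Exec (p a) (store f (Function.update t τ w) n) s m) :
    Exec (pop (Sum.inl τ) p) (store f t n) s (m + 1) := by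
  refine Exec.pop_cons (a := a) (l := w) h ?_
  exact hp.of_eq (congrArg (Store.mk f) (update_store_inl (f := f) τ w)) rfl

/-- The families `f`, `t`, `n` form a loop invariant indexed by the round. The counter is popped
before the body runs, so in round `i` the body sees `m - (i + 1)`. The proof is by induction on the
number of remaining rounds. -/
theorem exec_loopCtr {c : Ctr} {p : Prog} {B m : ℕ} (f : ℕ → Bool)
    (t : ℕ → Tape → List (Option Bool)) (n : ℕ → Ctr → ℕ) (hn : ∀ i ≤ m, n i c = m - i)
    (hp : ∀ i < m, Exec p (store (f i) (t i) (Function.update (n i) c (m - (i + 1))))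
      (store (f (i + 1)) (t (i + 1)) (n (i + 1))) B) :
    Exec (loopCtr c p) (store (f 0) (t 0) (n 0)) (store (f m) (t m) (n m)) (m * (B + 1) + 1) := by
  suffices h : ∀ j ≤ m, Exec (loopCtr c p) (store (f (m - j)) (t (m - j)) (n (m - j)))
      (store (f m) (t m) (n m)) (j * (B + 1) + 1) by
    simpa using h m le_rfl
  intro j
  induction j with
  | zero =>
    intro _
    exact (Exec.loop_nil (by simp [store, hn])).mono (by omega)
  | succ j ih =>
    intro hj
    have h1 := hp (m - (j + 1)) (by omega)
    have e : m - (j + 1) + 1 = m - j := by omega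
    rw [e] at h1
    refine (Exec.loop_cons (a := none) (l := List.replicate j none) ?_ ?_ (ih (by omega))).mono
      (t := B + (j * (B + 1) + 1) + 1) (by ring_nf; omega)
    · refine (store_stk_inr (f := f 0) (t := t 0) (n := n (m - (j + 1))) c).trans ?_
      rw [hn _ (Nat.sub_le m (j + 1)), show m - (m - (j + 1)) = j + 1 by omega]
      rfl
    · refine h1.of_eq ?_ rfl
      rw [show m - (m - j) = j by omega]
      exact congrArg (Store.mk _) (update_store_inr (f := true) c j)

theorem exec_loopTape {τ : Tape} {p : Option Bool → Prog} {B : ℕ} (w : List (Option Bool))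
    (t : ℕ → Tape → List (Option Bool)) (n : ℕ → Ctr → ℕ)
    (ht : ∀ i ≤ w.length, t i τ = w.drop i)
    (hp : ∀ i (hi : i < w.length), Exec (p w[i])
      (store f (Function.update (t i) τ (w.drop (i + 1))) (n i))
      (store f (t (i + 1)) (n (i + 1))) B) :
    Exec (loop (Sum.inl τ) p) (store f (t 0) (n 0)) (store f (t w.length) (n w.length))
      (w.length * (B + 1) + 1) := by
  suffices h : ∀ j ≤ w.length, Exec (loop (Sum.inl τ) p)
      (store f (t (w.length - j)) (n (w.length - j)))
      (store f (t w.length) (n w.length)) (j * (B + 1) + 1) by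
    simpa using h w.length le_rfl
  intro j
  induction j with
  | zero =>
    intro _
    exact (Exec.loop_nil (by simp [store, ht])).mono (by omega)
  | succ j ih =>
    intro hj
    have h1 := hp (w.length - (j + 1)) (by omega)
    have e : w.length - (j + 1) + 1 = w.length - j := by omega
    refine (Exec.loop_cons (a := w[w.length - (j + 1)]'(by omega))
      (l := w.drop (w.length - (j + 1) + 1)) ?_ ?_ (ih (by omega))).mono
      (t := B + (j * (B + 1) + 1) + 1) (by ring_nf; omega)
    · refine (ht _ (Nat.sub_le _ (j + 1))).trans ?_
      rw [List.getElem_cons_drop]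
    · refine (h1.of_eq ?_ rfl).of_eq rfl (by rw [e])
      exact congrArg (Store.mk _) (update_store_inl (f := f) τ _)

/-- Add a counter to another one. -/
def move (a b : Ctr) : Prog := loopCtr a (inc b)

theorem exec_move {a b : Ctr} (hab : a ≠ b) :
    Exec (move a b) (store f t n)
      (store f t (Function.update (Function.update n a 0) b (n b + n a))) (2 * n a + 1) := by
  refine ((exec_loopCtr (m := n a) (B := 1) (fun _ => f) (fun _ => t)
    (fun i => Function.update (Function.update n a (n a - i)) b (n b + i)) ?_ ?_).of_eq
      ?_ ?_).mono (by omega)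
  · intro i _
    simp [hab]
  · intro i hi
    refine (exec_inc b).of_eq rfl ?_
    congr 1
    funext k
    simp only [Function.update_apply]
    grind
  · simp
  · simp

/-- Set the flag when the first number is smaller than the second. -/
def less (a b : Ctr) : Prog :=
  seq (loopCtr a (seq (inc .tmp) (popCtr b (inc .tmp'))))
    (seq (setFlag false)
      (seq (popCtr b (seq (inc b) (setFlag true)))
        (seq (move .tmp' b) (move .tmp a))))

/-- Counting both down together leaves the truncated difference `n b - n a` in `b`, which is
positive exactly when `n a < n b`. Meanwhile `.tmp` and `.tmp'` record what was removed, the latter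
only `min (n a) (n b)`, so that both counters can be restored. -/
theorem exec_less {a b : Ctr} (hab : a ≠ b) (ha : a ≠ .tmp) (ha' : a ≠ .tmp') (hb : b ≠ .tmp)
    (hb' : b ≠ .tmp') (h : n .tmp = 0) (h' : n .tmp' = 0) :
    Exec (less a b) (store f t n) (store (decide (n a < n b)) t n) (8 * n a + 8) := by
  have hl := exec_loopCtr (c := a) (p := seq (inc .tmp) (popCtr b (inc .tmp'))) (m := n a)
    (B := 3) (fun _ => f) (fun _ => t)
    (fun i => Function.update (Function.update (Function.update (Function.update n a (n a - i))
      b (n b - i)) .tmp i) .tmp' (min i (n b)))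
    (by intro i _; simp [hab, ha, ha'])
    (by
      intro i hi
      refine (Exec.seq (exec_inc _) (t' := 2) ?_).mono (by omega)
      by_cases hc : n b ≤ i
      · refine ((exec_popCtr_zero ?_).mono (by omega : 1 ≤ 2)).of_eq rfl ?_
        · simp [hab.symm, hb, hb']; omega
        · congr 1
          funext k
          simp only [Function.update_apply]
          grind
      · refine (exec_popCtr_succ (k := n b - (i + 1)) ?_ (exec_inc _)).of_eq rfl ?_
        · simp [hab.symm, hb, hb']; omega
        · congr 1
          funext k
          simp only [Function.update_apply]
          grind)
  have e0 : (Function.update (Function.update (Function.update (Function.update n a (n a - 0))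
      b (n b - 0)) .tmp 0) .tmp' (min 0 (n b))) = n := by
    funext k
    simp only [Function.update_apply]
    grind
  simp only [e0] at hl
  refine (Exec.seq hl (Exec.seq (exec_setFlag false) (Exec.seq (t := 3)
    (s' := store (decide (n a < n b)) t (Function.update (Function.update (Function.update
      (Function.update n a (n a - n a)) b (n b - n a)) .tmp (n a)) .tmp' (min (n a) (n b)))) ?_
    (Exec.seq ((exec_move hb'.symm).mono (t' := 2 * n a + 1) ?_)
      (((exec_move ha.symm).of_eq rfl ?_).mono (t' := 2 * n a + 1) ?_))))).mono ?_
  · by_cases hc : n b ≤ n a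
    · rw [decide_eq_false (by omega)]
      refine (exec_popCtr_zero ?_).mono (by omega)
      simp [hb, hb']; omega
    · rw [decide_eq_true (by omega)]
      refine exec_popCtr_succ (k := n b - n a - 1) ?_
        ((Exec.seq (exec_inc b) (exec_setFlag true)).of_eq rfl ?_)
      · simp [hb, hb']; omega
      · congr 1
        funext k
        simp only [Function.update_apply]
        grind
  · simp
  · congr 1
    funext k
    simp only [Function.update_apply]
    grind
  · simp [hb.symm]
  · omega
end StackProg

/-! ### Reading entries of the adjacency matrix. -/

namespace StackProg

variable {f : Bool} {t : Tape → List (Option Bool)} {n : Ctr → ℕ}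

/-- The tapes when `k` symbols of the input word `w` have been read. -/
def tapesAt (w : List (Option Bool)) (k : ℕ) (o : List (Option Bool)) : Tape → List (Option Bool)
  | .mat => w.drop k
  | .buf => (w.take k).reverse
  | .out => o

/-- Read one symbol of the input word. -/
def advance : Prog := pop (Sum.inl .mat) fun a => write .buf a

/-- No bound on `k` is needed: past the end of the word nothing is popped, and `tapesAt` is constant
there. -/
theorem exec_advance (w : List (Option Bool)) (k : ℕ) (o : List (Option Bool)) :
    Exec advance (store f (tapesAt w k o) n) (store f (tapesAt w (k + 1) o) n) 2 := by
  by_cases hk : k < w.length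
  · refine (exec_popTape_cons (a := w[k]) (w := w.drop (k + 1)) ?_ (exec_write _ _)).of_eq rfl ?_
    · simp [tapesAt]
    · congr 1
      funext τ
      cases τ
      · simp [tapesAt]
      · rw [Function.update_self]
        simp only [tapesAt, ne_eq, reduceCtorEq, not_false_eq_true, Function.update_of_ne]
        rw [List.take_succ_eq_append_getElem hk, List.reverse_append]
        rfl
      · simp [tapesAt]
  · have hk : w.length ≤ k := by omega
    refine ((Exec.pop_nil ?_).mono (by omega : 1 ≤ 2)).of_eq rfl ?_
    · rw [store_stk_inl]
      simp [tapesAt, hk]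
    · congr 1
      funext τ
      cases τ <;> simp [tapesAt, List.drop_eq_nil_of_le, List.take_of_length_le, hk,
        (by omega : w.length ≤ k + 1)]

/-- Read a row of the input matrix. -/
def skipRow : Prog :=
  -- The loop consumes `.len`, hence the copy in `.len'`; the extra `advance` reads the separator of
  -- the row.
  seq (loopCtr .len (seq (inc .len') advance)) (seq advance (move .len' .len))

theorem exec_skipRow (w : List (Option Bool)) (k : ℕ) (o : List (Option Bool))
    (h : n .len' = 0) :
    Exec skipRow (store f (tapesAt w k o) n) (store f (tapesAt w (k + (n .len + 1)) o) n)
      (6 * n .len + 4) := by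
  have hl := exec_loopCtr (c := .len) (p := seq (inc .len') advance) (m := n .len)
    (B := 3) (fun _ => f) (fun i => tapesAt w (k + i) o)
    (fun i => Function.update (Function.update n .len (n .len - i)) .len' i)
    (by intro i _; simp)
    (by
      intro i hi
      refine ((exec_inc _).seq (exec_advance _ _ _)).of_eq rfl ?_
      congr 1
      funext x
      simp only [Function.update_apply]
      grind)
  refine ((hl.of_eq ?_ rfl).seq ((exec_advance _ _ _).seq ((exec_move (by decide)).of_eq rfl
    ?_))).mono ?_
  · congr 1
    funext x
    simp only [Function.update_apply]
    grind
  · rw [show k + (n .len + 1) = k + n .len + 1 by ring]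
    congr 1
    funext x
    simp only [Function.update_apply]
    grind
  · simp
    omega

/-- Write back the part of the input word already read. -/
def rewind : Prog := loop (Sum.inl .buf) fun a => write .mat a

theorem exec_rewind (w : List (Option Bool)) (k : ℕ) (o : List (Option Bool)) :
    Exec rewind (store f (tapesAt w k o) n) (store f (tapesAt w 0 o) n) (2 * k + 1) := by
  refine ((exec_loopTape (f := f) (B := 1) (w.take k).reverse
    (fun i => Function.update (Function.update (tapesAt w k o) .buf ((w.take k).reverse.drop i))
      .mat (((w.take k).reverse.take i).reverse ++ w.drop k)) (fun _ => n) ?_ ?_).of_eq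
      ?_ ?_).mono ?_
  · intro i _
    simp
  · intro i hi
    refine (exec_write _ _).of_eq rfl ?_
    congr 1
    funext τ
    cases τ
    · rw [Function.update_self, Function.update_self, List.take_succ_eq_append_getElem hi,
        List.reverse_append]
      simp
    · simp
    · simp
  · congr 1
    funext τ
    cases τ <;> simp [tapesAt]
  · congr 1
    funext τ
    cases τ
    · simp [tapesAt, -List.length_reverse, List.take_length]
    · simp [tapesAt]
    · simp [tapesAt]
  · simp
    omega

/-- Set the flag when the next symbol of the input word is `some true`. -/
def test : Prog :=
  seq (setFlag false) (pop (Sum.inl .mat) fun a =>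
    seq (write .mat a) (setFlag (decide (a = some true))))

theorem exec_test {w : List (Option Bool)} {k : ℕ} {o : List (Option Bool)} {a : Option Bool}
    (h : w[k]? = some a) :
    Exec test (store f (tapesAt w k o) n) (store (decide (a = some true)) (tapesAt w k o) n) 4 := by
  obtain ⟨hk, rfl⟩ := List.getElem?_eq_some_iff.1 h
  refine ((exec_setFlag _).seq (exec_popTape_cons
    (p := fun a => seq (write .mat a) (setFlag (decide (a = some true))))
    (a := w[k]) (w := w.drop (k + 1)) ?_ ((exec_write _ _).seq (exec_setFlag _)))).of_eq rfl ?_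
  · simp [tapesAt]
  · congr 1
    funext τ
    cases τ <;> simp [tapesAt]

/-- Set the flag when an entry of the input matrix is `true`. -/
def testEntry (a b : Ctr) : Prog :=
  seq (loopCtr a (seq (inc .tmp) skipRow)) (seq (move .tmp a)
    (seq (loopCtr b (seq (inc .tmp) advance)) (seq (move .tmp b) (seq test rewind))))

/-- With its separator a row occupies `n .len + 1` symbols, which gives the position of the entry.
The counters may coincide, since `a` is restored before `b` is used. -/
theorem exec_testEntry {a b : Ctr} (ha : a ≠ .tmp) (hb : b ≠ .tmp) (ha' : a ≠ .len)
    (ha'' : a ≠ .len') {w o : List (Option Bool)} {x : Option Bool}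
    (h : n .tmp = 0) (h' : n .len' = 0) (hal : n a ≤ n .len) (hbl : n b ≤ n .len)
    (hw : w[n a * (n .len + 1) + n b]? = some x) :
    Exec (testEntry a b) (store f (tapesAt w 0 o) n)
      (store (decide (x = some true)) (tapesAt w 0 o) n) (20 * (n .len + 1) ^ 2) := by
  have h1 := exec_loopCtr (c := a) (p := seq (inc .tmp) skipRow) (m := n a)
    (B := 6 * n .len + 5) (fun _ => f) (fun i => tapesAt w (i * (n .len + 1)) o)
    (fun i => Function.update (Function.update n a (n a - i)) .tmp i)
    (by intro i _; simp [ha])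
    (by
      intro i hi
      refine (((exec_inc _).seq (exec_skipRow _ _ _ ?_)).of_eq rfl ?_).mono ?_
      · simp [ha''.symm, h']
      · simp only [Function.update_apply]
        rw [show (i + 1) * (n .len + 1) = i * (n .len + 1) + (n .len + 1) by ring]
        simp only [reduceCtorEq, ha'.symm, if_false]
        congr 1
        funext y
        simp only [Function.update_apply]
        grind
      · simp [ha'.symm]; omega)
  have h2 := exec_loopCtr (c := b) (p := seq (inc .tmp) advance) (m := n b)
    (B := 3) (fun _ => f) (fun i => tapesAt w (n a * (n .len + 1) + i) o)
    (fun i => Function.update (Function.update n b (n b - i)) .tmp i)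
    (by intro i _; simp [hb])
    (by
      intro i hi
      refine ((exec_inc _).seq (exec_advance _ _ _)).of_eq rfl ?_
      congr 1
      funext y
      simp only [Function.update_apply]
      grind)
  refine ((h1.of_eq ?_ rfl).seq (((exec_move ha.symm).of_eq rfl ?_).seq (h2.seq
    (((exec_move hb.symm).of_eq rfl ?_).seq ((exec_test (f := f) hw).seq (exec_rewind _ _ _)))))).mono ?_
  · simp only [zero_mul]
    congr 1
    funext y
    simp only [Function.update_apply]
    grind
  · simp only [add_zero]
    congr 1
    funext y
    simp only [Function.update_apply]
    grind
  · congr 1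
    funext y
    simp only [Function.update_apply]
    grind
  · simp only [Function.update_self]
    generalize n a = i at *
    generalize n b = j at *
    generalize n .len = L at *
    have h3 : i * (6 * L + 5 + 1) ≤ L * (6 * L + 5 + 1) := Nat.mul_le_mul_right _ hal
    have h4 : i * (L + 1) ≤ L * (L + 1) := Nat.mul_le_mul_right _ hal
    nlinarith

end StackProg

namespace FinGraph

theorem drop_flatMap_of_length {α β : Type*} {l : List α} {g : α → List β} {m : ℕ}
    (hg : ∀ a ∈ l, (g a).length = m) (i : ℕ) :
    (l.flatMap g).drop (i * m) = (l.drop i).flatMap g := by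
  induction i generalizing l with
  | zero => simp
  | succ i ih =>
    cases l with
    | nil => simp
    | cons a l =>
      rw [List.flatMap_cons, Nat.succ_mul, Nat.add_comm, ← List.drop_drop, List.drop_left' (hg a (by simp)),
        ih fun b hb => hg b (by simp [hb])]
      rfl

open Classical in
theorem encode_getElem? (G : FinGraph) (i j : Fin G.n) :
    G.encode[(i : ℕ) * (G.n + 1) + j]? = some (some (decide (G.graph.Adj i j))) := by
  unfold encode
  rw [← List.getElem?_drop, drop_flatMap_of_length (by simp),
    List.drop_eq_getElem_cons (by simp), List.flatMap_cons, List.getElem?_append_left (by simp),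
    List.getElem?_append_left (by simp)]
  simp

theorem length_encode (G : FinGraph) : G.encode.length = G.n * (G.n + 1) := by
  unfold encode
  simp

end FinGraph

/-! ### Evaluation of first-order formulas by nested loops. -/

namespace StackProg

/-- A partial assignment of vertices to the variables. -/
abbrev Env (N : ℕ) := Fin 8 → Option (Fin N)

/-- The counters that represent an assignment. -/
def ctrs {N : ℕ} (e : Env N) (m : ℕ) : Ctr → ℕ
  | .cnt => m
  | .len => N
  | .len' => 0
  | .tmp => 0
  | .tmp' => 0
  | .lo v => (e v).elim 0 fun i => i
  | .hi v => (e v).elim N fun i => N - (i + 1)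

/-- The memory that represents a graph, an assignment, a number, an output word and the flag. -/
noncomputable def base {G : FinGraph} (e : Env G.n) (m : ℕ) (o : List (Option Bool)) (f : Bool) :
    Store (Tape ⊕ Ctr) (Option Bool) :=
  store f (tapesAt G.encode 0 o) (ctrs e m)

variable {G : FinGraph} {e : Env G.n} {m : ℕ} {o : List (Option Bool)} {f : Bool}

/-- Run a program for all values of a variable. -/
def forVar (v : Fin 8) (p : Prog) : Prog :=
  seq (loopCtr (.hi v) (seq p (inc (.lo v)))) (move (.lo v) (.hi v))

/-- After the pop in round `i` the counters `.lo v` and `.hi v` hold `i` and `n - (i + 1)`, which is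
exactly how the value `i` is represented. At the end they hold `n` and `0`, and one `move` makes the
variable unassigned again. -/
theorem exec_forVar {v : Fin 8} {p : Prog} {B : ℕ} (hv : e v = none) (m : ℕ → ℕ)
    (o : ℕ → List (Option Bool)) (f : ℕ → Bool)
    (hp : ∀ i : Fin G.n, Exec p (base (Function.update e v (some i)) (m i) (o i) (f i))
      (base (Function.update e v (some i)) (m (i + 1)) (o (i + 1)) (f (i + 1))) B) :
    Exec (forVar v p) (base e (m 0) (o 0) (f 0)) (base e (m G.n) (o G.n) (f G.n))
      (G.n * (B + 4) + 2) := by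
  have hl := exec_loopCtr (c := .hi v) (p := seq p (inc (.lo v))) (m := G.n) (B := B + 1)
    f (fun i => tapesAt G.encode 0 (o i))
    (fun i => Function.update (Function.update (ctrs e (m i)) (.hi v) (G.n - i)) (.lo v) i)
    (by intro i _; simp)
    (by
      intro i hi
      refine ((hp ⟨i, hi⟩).of_eq ?_ rfl).seq ((exec_inc _).of_eq rfl ?_)
      · unfold base
        congr 1
        funext x
        cases x <;> simp only [Function.update_apply, ctrs] <;> grind
      · congr 1
        funext x
        cases x <;> simp only [Function.update_apply, ctrs] <;> grind)
  refine ((hl.of_eq ?_ rfl).seq ((exec_move (by simp)).of_eq rfl ?_)).mono ?_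
  · unfold base
    congr 1
    funext x
    cases x <;> simp only [Function.update_apply, ctrs] <;> grind
  · unfold base
    congr 1
    funext x
    cases x <;> simp only [Function.update_apply, ctrs] <;> grind
  · simp
    ring_nf
    omega

/-- The case in which each round adds to the number and to the output independently of what is there
already. The output is a stack, so words appear reversed. -/
theorem exec_forVar_acc {v : Fin 8} {p : Prog} {B : ℕ} (hv : e v = none) (k : Fin G.n → ℕ)
    (w : Fin G.n → List (Option Bool))
    (hp : ∀ i m o, Exec p (base (Function.update e v (some i)) m o false)
      (base (Function.update e v (some i)) (m + k i) ((w i).reverse ++ o) false) B) :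
    Exec (forVar v p) (base e m o false)
      (base e (m + ((List.finRange G.n).map k).sum)
        (((List.finRange G.n).flatMap w).reverse ++ o) false)
      (G.n * (B + 4) + 2) := by
  refine (exec_forVar hv (fun i => m + (((List.finRange G.n).take i).map k).sum)
    (fun i => (((List.finRange G.n).take i).flatMap w).reverse ++ o) (fun _ => false)
    fun i => ((hp i _ _).of_eq rfl ?_)).of_eq ?_ ?_
  · rw [List.take_succ_eq_append_getElem (by simp)]
    simp [add_assoc]
  · simp
  · rw [List.take_of_length_le (by simp)]

/-- First-order formulas about graphs with a linear order on the vertices. -/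
inductive Fml
  /-- adjacency -/
  | adj (u v : Fin 8)
  /-- the order -/
  | lt (u v : Fin 8)
  /-- negation -/
  | not (φ : Fml)
  /-- conjunction -/
  | and (φ ψ : Fml)
  /-- existential quantification -/
  | ex (v : Fin 8) (φ : Fml)

namespace Fml

/-- The semantics of formulas. -/
def Sat (G : FinGraph) : Env G.n → Fml → Prop
  | e, adj u v => ∃ i j, e u = some i ∧ e v = some j ∧ G.graph.Adj i j
  | e, lt u v => ∃ i j, e u = some i ∧ e v = some j ∧ i < j
  | e, not φ => ¬ Sat G e φ
  | e, and φ ψ => Sat G e φ ∧ Sat G e ψ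
  | e, ex v φ => ∃ i, Sat G (Function.update e v (some i)) φ

/-- A formula is admissible, with a given set of free variables, when no variable is quantified
twice and no variable is compared with itself. -/
def Admissible : Finset (Fin 8) → Fml → Prop
  | A, adj u v => u ∈ A ∧ v ∈ A
  | A, lt u v => u ∈ A ∧ v ∈ A ∧ u ≠ v
  | A, not φ => Admissible A φ
  | A, and φ ψ => Admissible A φ ∧ Admissible A ψ
  | A, ex v φ => v ∉ A ∧ Admissible (insert v A) φ

/-- A program that sets the flag to the truth value of a formula. -/
def prog : Fml → Prog
  | adj u v => testEntry (.lo u) (.lo v)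
  | lt u v => less (.lo u) (.lo v)
  | not φ => seq φ.prog (ite (setFlag false) (setFlag true))
  | and φ ψ => seq φ.prog (ite ψ.prog skip)
  | ex v φ => seq (setFlag false) (forVar v (ite skip φ.prog))

open Polynomial in
/-- A bound for the running time of the evaluation of a formula. -/
noncomputable def time : Fml → Polynomial ℕ
  | adj _ _ => 20 * (X + 1) ^ 2
  | lt _ _ => 8 * X + 8
  | not φ => φ.time + 2
  | and φ ψ => φ.time + ψ.time + 2
  | ex _ φ => X * (φ.time + 6) + 3

-- Admissibility guarantees that a quantified variable is unassigned when its loop starts, and that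
-- `less` never compares a counter with itself.
open Classical in
theorem exec_prog {A : Finset (Fin 8)} {φ : Fml} (hφ : φ.Admissible A)
    (hA : ∀ v, v ∈ A ↔ (e v).isSome) :
    Exec φ.prog (base e m o f) (base e m o (decide (Sat G e φ))) (φ.time.eval G.n) := by
  induction φ generalizing A e f with
  | adj u v =>
    obtain ⟨i, hi⟩ := Option.isSome_iff_exists.1 ((hA u).1 hφ.1)
    obtain ⟨j, hj⟩ := Option.isSome_iff_exists.1 ((hA v).1 hφ.2)
    refine ((exec_testEntry (by simp) (by simp) (by simp) (by simp) rfl rfl ?_ ?_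
      (x := some (decide (G.graph.Adj i j))) ?_).of_eq rfl ?_).mono ?_
    · simp [ctrs, hi, i.2.le]
    · simp [ctrs, hj, j.2.le]
    · simpa [ctrs, hi, hj] using G.encode_getElem? i j
    · unfold base
      simp [Sat, hi, hj]
    · simp [time, ctrs]
  | lt u v =>
    obtain ⟨i, hi⟩ := Option.isSome_iff_exists.1 ((hA u).1 hφ.1)
    obtain ⟨j, hj⟩ := Option.isSome_iff_exists.1 ((hA v).1 hφ.2.1)
    refine ((exec_less (by simpa using hφ.2.2) (by simp) (by simp) (by simp) (by simp) rfl
      rfl).of_eq rfl ?_).mono ?_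
    · unfold base
      simp [Sat, hi, hj, ctrs]
    · simp [time, ctrs, hi, i.2.le]
  | not φ ih =>
    refine (Exec.seq (ih hφ hA) (t' := 2) ?_).mono (by simp [time])
    by_cases h : Sat G e φ
    · simp only [h, decide_true, Sat, not_true, decide_false]
      exact Exec.ite_true (exec_setFlag _)
    · simp only [h, decide_true, Sat, not_false_iff, decide_false]
      exact Exec.ite_false (exec_setFlag _)
  | and φ ψ ih ih' =>
    refine (Exec.seq (ih hφ.1 hA) (t' := ψ.time.eval G.n + 2) ?_).mono (by simp [time]; omega)
    by_cases h : Sat G e φ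
    · simp only [h, decide_true, Sat, true_and]
      exact (Exec.ite_true (ih' hφ.2 hA)).mono (by omega)
    · simp only [h, decide_false, Sat, false_and]
      exact (Exec.ite_false (Exec.skip _)).mono (by omega)
  | ex v φ ih =>
    have hv : e v = none := by
      have := (hA v).not.1 hφ.1
      simpa using this
    -- Invariant: after `k` rounds the flag says whether a witness below `k` exists. Once the flag
    -- is set the body is skipped.
    refine (Exec.seq (exec_setFlag _) ((exec_forVar (B := φ.time.eval G.n + 2) hv (fun _ => m)
      (fun _ => o) (fun k => decide (∃ i : Fin G.n, i < k ∧ Sat G (Function.update e v (some i)) φ))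
      ?_).of_eq ?_ ?_)).mono (by simp [time]; ring_nf; omega)
    · intro i
      by_cases h : ∃ j : Fin G.n, j < (i : ℕ) ∧ Sat G (Function.update e v (some j)) φ
      · obtain ⟨j, hj, h⟩ := h
        rw [decide_eq_true ⟨j, hj, h⟩, decide_eq_true ⟨j, by omega, h⟩]
        exact (Exec.ite_true (Exec.skip _)).mono (by omega)
      · have hi := ih (e := Function.update e v (some i)) (f := false) hφ.2 (by
          intro u
          by_cases huv : u = v
          · subst huv; simp
          · simp [huv, hA])
        refine ((Exec.ite_false hi).mono (t' := φ.time.eval G.n + 2) (by omega)).of_eq ?_ ?_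
        · rw [decide_eq_false h]; rfl
        · congr 1
          rw [decide_eq_decide]
          constructor
          · exact fun hs => ⟨i, by omega, hs⟩
          · rintro ⟨j, hj, hs⟩
            rcases Nat.lt_succ_iff_lt_or_eq.1 hj with hj | hj
            · exact absurd ⟨j, hj, hs⟩ h
            · rwa [Fin.ext hj] at hs
    · simp [base]
    · congr 1
      rw [decide_eq_decide]
      simp [Sat]

end Fml
end StackProg

/-! ### Writing down a graph that is defined by formulas on pairs of vertices. -/

namespace StackProg

/-- Empty some stacks. -/
def clear {K S : Type} : List K → StackProg K S
  | [] => skip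
  | k :: ks => seq (loop k fun _ => skip) (clear ks)

theorem exec_loop_skip {K S : Type} [DecidableEq K] (f : Bool) (stk : K → List S) (k : K) :
    Exec (loop k fun _ => skip) ⟨f, stk⟩ ⟨f, Function.update stk k []⟩
      (2 * (stk k).length + 1) := by
  generalize hw : stk k = w
  induction w generalizing stk with
  | nil =>
    refine (Exec.loop_nil hw).of_eq rfl ?_
    rw [← hw, Function.update_eq_self]
  | cons a w ih =>
    refine ((Exec.loop_cons hw (Exec.skip _) (ih _ (Function.update_self ..))).of_eq rfl ?_).mono ?_
    · rw [Function.update_idem]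
    · simp only [List.length_cons]
      omega

theorem exec_clear {K S : Type} [DecidableEq K] (f : Bool) (stk : K → List S) (B : ℕ)
    (ks : List K) (hB : ∀ k ∈ ks, (stk k).length ≤ B) :
    Exec (clear ks) ⟨f, stk⟩ ⟨f, fun k => if k ∈ ks then [] else stk k⟩
      (ks.length * (2 * B + 1) + 1) := by
  induction ks generalizing stk with
  | nil => exact (Exec.skip _).of_eq rfl (by simp) |>.mono (by simp)
  | cons k ks ih =>
    refine ((exec_loop_skip f stk k).seq ((ih (Function.update stk k []) ?_).of_eq rfl
      ?_)).mono ?_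
    · intro k' hk'
      by_cases h : k' = k
      · subst h; simp
      · simpa [h] using hB k' (by simp [hk'])
    · congr 1
      funext k'
      by_cases h : k' = k
      · subst h; simp
      · simp [h]
    · have := hB k (by simp)
      simp only [List.length_cons]
      ring_nf
      omega

/-- Write a word on the output tape. -/
def writeWord : List (Option Bool) → Prog
  | [] => skip
  | a :: w => seq (write .out a) (writeWord w)

theorem exec_writeWord {f : Bool} {t : Tape → List (Option Bool)} {n : Ctr → ℕ}
    (w : List (Option Bool)) :
    Exec (writeWord w) (store f t n)
      (store f (Function.update t .out (w.reverse ++ t .out)) n) (w.length + 1) := by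
  induction w generalizing t with
  | nil => exact (Exec.skip _).of_eq rfl (by simp)
  | cons a w ih =>
    refine (((exec_write _ _).seq ih).of_eq rfl ?_).mono ?_
    · simp
    · simp only [List.length_cons]
      omega

theorem exec_writeWord_base {G : FinGraph} {e : Env G.n} {m : ℕ} {o : List (Option Bool)}
    {f : Bool} (w : List (Option Bool)) :
    Exec (writeWord w) (base e m o f) (base e m (w.reverse ++ o) f) (w.length + 1) := by
  refine (exec_writeWord w).of_eq rfl ?_
  unfold base
  congr 1
  funext τ
  cases τ <;> simp [tapesAt]

theorem exec_setFlag_base {G : FinGraph} {e : Env G.n} {m : ℕ} {o : List (Option Bool)}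
    {f : Bool} (b : Bool) : Exec (setFlag b) (base e m o f) (base e m o b) 1 :=
  exec_setFlag b

theorem exec_inc_cnt_base {G : FinGraph} {e : Env G.n} {m : ℕ} {o : List (Option Bool)}
    {f : Bool} : Exec (inc .cnt) (base e m o f) (base e (m + 1) o f) 1 := by
  refine (exec_inc _).of_eq rfl ?_
  unfold base
  congr 1
  funext c
  cases c <;> simp [ctrs]

theorem exec_ite_base_pos {G : FinGraph} {e : Env G.n} {m k : ℕ} {o : List (Option Bool)}
    {P : Prop} [Decidable P] {p q : Prog} {s : Store (Tape ⊕ Ctr) (Option Bool)} (h : P)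
    (hp : Exec p (base e m o true) s k) : Exec (ite p q) (base e m o (decide P)) s (k + 1) := by
  rw [decide_eq_true h]
  exact Exec.ite_true hp

theorem exec_ite_base_neg {G : FinGraph} {e : Env G.n} {m k : ℕ} {o : List (Option Bool)}
    {P : Prop} [Decidable P] {p q : Prog} {s : Store (Tape ⊕ Ctr) (Option Bool)} (h : ¬ P)
    (hq : Exec q (base e m o false) s k) : Exec (ite p q) (base e m o (decide P)) s (k + 1) := by
  rw [decide_eq_false h]
  exact Exec.ite_false hq

/-- Increment the counters that hold the number of vertices. -/
def countUp : Prog :=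
  seq (inc .len) (seq (inc (.hi 0)) (seq (inc (.hi 1)) (seq (inc (.hi 2)) (seq (inc (.hi 3))
    (seq (inc (.hi 4)) (seq (inc (.hi 5)) (seq (inc (.hi 6)) (inc (.hi 7)))))))))

/-- The counters when `k` rows of the input matrix have been counted. -/
def initCtrs (k : ℕ) : Ctr → ℕ
  | .len => k
  | .hi _ => k
  | _ => 0

theorem exec_countUp {f : Bool} {t : Tape → List (Option Bool)} {k : ℕ} :
    Exec countUp (store f t (initCtrs k)) (store f t (initCtrs (k + 1))) 9 := by
  refine ((exec_inc _).seq ((exec_inc _).seq ((exec_inc _).seq ((exec_inc _).seq ((exec_inc _).seq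
    ((exec_inc _).seq ((exec_inc _).seq ((exec_inc _).seq (exec_inc _))))))))).of_eq rfl ?_
  congr 1
  funext x
  cases x with
  | hi v => fin_cases v <;> simp [initCtrs]
  | _ => simp [initCtrs]

/-- Determine the number of vertices. -/
def init : Prog :=
  seq (loop (Sum.inl .mat) fun a => seq (write .buf a) (if a = none then countUp else skip)) rewind

/-- Matrix entries have the form `some _`, so each row contributes just its separator. This is how
`init` finds the number of vertices. -/
theorem count_none_encode (G : FinGraph) : G.encode.count none = G.n := by
  unfold FinGraph.encode
  rw [List.count_flatMap, List.map_congr_left (g := fun _ => 1)]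
  · simp
  · intro i _
    simp [List.count_eq_zero]

theorem exec_init (G : FinGraph) :
    Exec init ⟨false, Function.update (fun _ => []) (Sum.inl .mat) G.encode⟩
      (base (G := G) (fun _ => none) 0 [] false) (13 * G.encode.length + 2) := by
  have hl := exec_loopTape (f := false) (τ := .mat)
    (p := fun a => seq (write .buf a) (if a = none then countUp else skip)) (B := 10) G.encode
    (fun i => tapesAt G.encode i []) (fun i => initCtrs ((G.encode.take i).count none))
    (by intro i _; rfl)
    (by
      intro i hi
      refine (((exec_write .buf G.encode[i]).of_eq rfl (r' := store false
        (tapesAt G.encode (i + 1) []) (initCtrs ((G.encode.take i).count none))) ?_).seq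
        (t' := 9) ?_).mono le_rfl
      · congr 1
        funext τ
        cases τ
        · simp [tapesAt]
        · rw [Function.update_self]
          simp only [tapesAt, ne_eq, reduceCtorEq, not_false_eq_true, Function.update_of_ne]
          rw [List.take_succ_eq_append_getElem hi, List.reverse_append]
          rfl
        · simp [tapesAt]
      · rw [List.take_succ_eq_append_getElem hi, List.count_append]
        by_cases h : G.encode[i] = none
        · simp only [h, if_true]
          simpa using exec_countUp
        · simp only [h, if_false]
          refine ((Exec.skip _).mono (by omega)).of_eq rfl ?_
          simp [h])
  refine ((hl.of_eq ?_ rfl).seq ((exec_rewind _ _ _).of_eq rfl ?_)).mono ?_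
  · unfold store
    congr 1
    funext x
    rcases x with x | x
    · cases x <;> simp [tapesAt]
    · cases x <;> simp [initCtrs]
  · unfold base
    congr 1
    rw [List.take_length, count_none_encode]
    funext x
    cases x <;> simp [initCtrs, ctrs]
  · omega

/-- The assignment of two vertices to the first two variables. -/
def envPair {N : ℕ} (p : Fin N × Fin N) : Env N :=
  Function.update (Function.update (fun _ => none) 0 (some p.1)) 1 (some p.2)

/-- The assignment of four vertices to the first four variables. -/
def envQuad {N : ℕ} (p q : Fin N × Fin N) : Env N :=
  Function.update (Function.update (envPair p) 2 (some q.1)) 3 (some q.2)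

open Classical in
/-- The pairs of vertices that satisfy a formula, in lexicographic order. -/
noncomputable def pairs (D : Fml) (G : FinGraph) : List (Fin G.n × Fin G.n) :=
  (List.finRange G.n ×ˢ List.finRange G.n).filter fun p => decide (Fml.Sat G (envPair p) D)

open Classical in
/-- The adjacency matrix of the graph on the pairs satisfying `D`, with edges given by `E`. -/
noncomputable def matrixWord (D E : Fml) (G : FinGraph) : List (Option Bool) :=
  (pairs D G).flatMap fun p =>
    ((pairs D G).map fun q => some (decide (Fml.Sat G (envQuad p q) E))) ++ [none]

/-- Count the pairs that satisfy a formula. -/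
def countPairs (D : Fml) : Prog :=
  forVar 0 (forVar 1 (seq D.prog (ite (seq (inc .cnt) (setFlag false)) skip)))

/-- Set the flag when a sentence holds and the number of pairs that satisfy a formula is at most
the number of vertices. -/
def checkPairs (Φ D : Fml) : Prog :=
  seq Φ.prog (ite (seq (setFlag false) (seq (countPairs D)
    (seq (less .len .cnt) (ite (setFlag false) (setFlag true))))) skip)

/-- Write the adjacency matrix of the graph on the pairs satisfying `D`, with edges given by `E`;
`D'` is a copy of `D` with other free variables. -/
def writeMatrix (D D' E : Fml) : Prog :=
  forVar 0 (forVar 1 (seq D.prog (ite (seq (setFlag false) (seq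
    (forVar 2 (forVar 3 (seq D'.prog (ite (seq E.prog (ite
      (seq (writeWord [some true]) (setFlag false))
      (writeWord [some false]))) skip))))
    (writeWord [none]))) skip)))

section
variable {G : FinGraph} {m : ℕ} {o : List (Option Bool)} {f : Bool}

open Classical Polynomial

/-- Both loops keep the flag `false` between rounds; this is why the programs reset it in the
branches entered with the flag set. -/
theorem exec_forPair {u v : Fin 8} {p : Prog} {B : ℕ} {e : Env G.n} (huv : v ≠ u)
    (hu : e u = none) (hv : e v = none) (k : Fin G.n × Fin G.n → ℕ)
    (w : Fin G.n × Fin G.n → List (Option Bool))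
    (hp : ∀ x m o, Exec p
      (base (Function.update (Function.update e u (some x.1)) v (some x.2)) m o false)
      (base (Function.update (Function.update e u (some x.1)) v (some x.2)) (m + k x)
        ((w x).reverse ++ o) false) B) :
    Exec (forVar u (forVar v p)) (base e m o false)
      (base e (m + ((List.finRange G.n ×ˢ List.finRange G.n).map k).sum)
        (((List.finRange G.n ×ˢ List.finRange G.n).flatMap w).reverse ++ o) false)
      ((B + 10) * (G.n + 1) ^ 2) := by
  refine ((exec_forVar_acc hu
    (fun i => ((List.finRange G.n).map fun j => k (i, j)).sum)
    (fun i => (List.finRange G.n).flatMap fun j => w (i, j)) fun i m o =>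
      exec_forVar_acc (by simp [huv, hv]) _ _ fun j m o => hp (i, j) m o).of_eq rfl ?_).mono ?_
  · congr 2
    · simp [SProd.sprod, List.product, List.flatMap, List.map_flatten, List.sum_flatten, Function.comp_def]
    · simp [SProd.sprod, List.product, List.flatMap_assoc, List.flatMap_map]
  · ring_nf
    nlinarith [Nat.zero_le (B * G.n)]

theorem sum_map_ite {α : Type*} (l : List α) (p : α → Prop) :
    (l.map fun x => if p x then 1 else 0).sum = (l.filter fun x => decide (p x)).length := by
  induction l with
  | nil => simp
  | cons a l ih =>
    by_cases h : p a
    · simp [h, ih, Nat.add_comm]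
    · simp [h, ih]

theorem flatMap_ite {α β : Type*} (l : List α) (p : α → Prop) (g : α → List β) :
    (l.flatMap fun x => if p x then g x else []) =
      (l.filter fun x => decide (p x)).flatMap g := by
  induction l with
  | nil => simp
  | cons a l ih =>
    by_cases h : p a
    · simp [h, ih]
    · simp [h, ih]

theorem mem_iff_envPair (x : Fin G.n × Fin G.n) (v : Fin 8) :
    v ∈ ({0, 1} : Finset (Fin 8)) ↔ (envPair x v).isSome := by
  fin_cases v <;> simp [envPair]

theorem mem_iff_envQuad (x y : Fin G.n × Fin G.n) (v : Fin 8) :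
    v ∈ ({0, 1, 2, 3} : Finset (Fin 8)) ↔ (envQuad x y v).isSome := by
  fin_cases v <;> simp [envPair, envQuad]

theorem exec_countPairs {D : Fml} (hD : D.Admissible {0, 1}) :
    Exec (countPairs D) (base (G := G) (fun _ => none) m o false)
      (base (G := G) (fun _ => none) (m + (pairs D G).length) o false)
      (((D.time + 13) * (X + 1) ^ 2 : Polynomial ℕ).eval G.n) := by
  rw [pairs, ← sum_map_ite]
  refine ((exec_forPair (B := D.time.eval G.n + 3) (by decide) rfl rfl
    (fun x => if Fml.Sat G (envPair x) D then 1 else 0) (fun _ => []) ?_).of_eq rfl ?_).mono ?_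
  · intro x m o
    refine Exec.seq (D.exec_prog hD (mem_iff_envPair x)) (t' := 3) ?_
    by_cases h : Fml.Sat G (envPair x) D
    · simp only [if_pos h]
      exact exec_ite_base_pos h (exec_inc_cnt_base.seq (exec_setFlag_base _))
    · simp only [if_neg h]
      exact (exec_ite_base_neg h (Exec.skip _)).mono (by omega)
  · congr 1
    simp
  · simp

/-- The number left in `.cnt` is irrelevant except for its bound, which limits the time needed to
clear it. -/
theorem exec_checkPairs {Φ D : Fml} (hΦ : Φ.Admissible ∅) (hD : D.Admissible {0, 1}) :
    ∃ m ≤ G.n ^ 2, Exec (checkPairs Φ D) (base (G := G) (fun _ => none) 0 o f)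
      (base (G := G) (fun _ => none) m o
        (decide (Fml.Sat G (fun _ => none) Φ ∧ (pairs D G).length ≤ G.n)))
      ((Φ.time + (D.time + 13) * (X + 1) ^ 2 + 8 * X + 13 : Polynomial ℕ).eval G.n) := by
  have h1 := Φ.exec_prog (G := G) (e := fun _ => none) (m := 0) (o := o) (f := f) hΦ (by simp)
  by_cases h : Fml.Sat G (fun _ => none) Φ
  · refine ⟨(pairs D G).length, ?_, (h1.seq (t' := ((D.time + 13) * (X + 1) ^ 2 + 8 * X + 13 :
      Polynomial ℕ).eval G.n) ?_).mono (by simp; omega)⟩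
    · unfold pairs
      refine (List.length_filter_le _ _).trans ?_
      simp [List.length_product, pow_two]
    rw [decide_eq_true h]
    refine (Exec.ite_true (t := ((D.time + 13) * (X + 1) ^ 2 + 8 * X + 12 :
      Polynomial ℕ).eval G.n) ?_).mono (by simp)
    refine ((exec_setFlag_base false).seq ((exec_countPairs hD).seq
      ((exec_less (by decide) (by decide) (by decide) (by decide) (by decide) rfl rfl).seq
      (t' := 2) ?_))).mono (by simp [ctrs]; omega)
    have e1 : decide (ctrs (fun _ => none : Env G.n) (0 + (pairs D G).length) .len
        < ctrs (fun _ => none : Env G.n) (0 + (pairs D G).length) .cnt)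
        = decide (G.n < (pairs D G).length) := by simp [ctrs]
    rw [e1, zero_add]
    by_cases h' : (pairs D G).length ≤ G.n
    · rw [decide_eq_false (by omega), decide_eq_true ⟨h, h'⟩]
      exact Exec.ite_false (exec_setFlag _)
    · rw [decide_eq_true (by omega), decide_eq_false (by tauto)]
      exact Exec.ite_true (exec_setFlag _)
  · refine ⟨0, by simp, (h1.seq (t' := 2) ?_).mono (by simp; omega)⟩
    rw [decide_eq_false h, decide_eq_false (by tauto)]
    exact Exec.ite_false (Exec.skip _)

theorem exec_writeMatrix {D D' E : Fml} (hD : D.Admissible {0, 1})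
    (hD' : D'.Admissible {0, 1, 2, 3}) (hE : E.Admissible {0, 1, 2, 3})
    (hDD' : ∀ x y : Fin G.n × Fin G.n, Fml.Sat G (envQuad x y) D' ↔ Fml.Sat G (envPair y) D) :
    Exec (writeMatrix D D' E) (base (G := G) (fun _ => none) m o false)
      (base (G := G) (fun _ => none) m ((matrixWord D E G).reverse ++ o) false)
      (((D.time + (D'.time + E.time + 20) * (X + 1) ^ 2 + 20) * (X + 1) ^ 2 :
        Polynomial ℕ).eval G.n) := by
  -- One row of the matrix, still without its separator.
  have inner : ∀ x m o, Exec (forVar 2 (forVar 3 (seq D'.prog (ite (seq E.prog (ite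
        (seq (writeWord [some true]) (setFlag false)) (writeWord [some false]))) skip))))
      (base (G := G) (envPair x) m o false)
      (base (G := G) (envPair x) m
        (((pairs D G).map fun y => some (decide (Fml.Sat G (envQuad x y) E))).reverse ++ o) false)
      (((D'.time + E.time + 20) * (X + 1) ^ 2 : Polynomial ℕ).eval G.n) := by
    intro x m o
    refine ((exec_forPair (B := D'.time.eval G.n + (E.time.eval G.n + 5)) (by decide) rfl rfl
      (fun _ => 0) (fun y => if Fml.Sat G (envPair y) D then
        [some (decide (Fml.Sat G (envQuad x y) E))] else []) ?_).of_eq rfl ?_).mono ?_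
    · intro y m o
      refine Exec.seq (D'.exec_prog hD' (mem_iff_envQuad x y)) (t' := E.time.eval G.n + 5) ?_
      by_cases h : Fml.Sat G (envPair y) D
      · have h' := (hDD' x y).2 h
        rw [envQuad] at h'
        simp only [h, if_true]
        refine exec_ite_base_pos h'
          (Exec.seq (E.exec_prog hE (mem_iff_envQuad x y)) (t' := 4) ?_)
        by_cases hs : Fml.Sat G (envQuad x y) E
        · simp only [hs, decide_true]
          exact exec_ite_base_pos hs ((exec_writeWord_base [some true]).seq (exec_setFlag_base _))
        · simp only [hs, decide_false]
          exact (exec_ite_base_neg hs (exec_writeWord_base [some false])).mono (by simp)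
      · have h' := (hDD' x y).not.2 h
        rw [envQuad] at h'
        simp only [h, if_false]
        exact (exec_ite_base_neg h' (Exec.skip _)).mono (by omega)
    · simp only [flatMap_ite, List.map_const', List.sum_replicate, smul_zero, add_zero]
      rw [← pairs, List.map_eq_flatMap]
    · simp only [eval_mul, eval_add, eval_pow, eval_X, eval_one, eval_ofNat]
      gcongr ?_ * _
      omega
  refine ((exec_forPair (B := (D.time + (D'.time + E.time + 20) * (X + 1) ^ 2 + 10 :
    Polynomial ℕ).eval G.n) (by decide) rfl rfl
    (fun _ => 0) (fun x => if Fml.Sat G (envPair x) D then ((pairs D G).map fun y =>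
      some (decide (Fml.Sat G (envQuad x y) E))) ++ [none] else []) ?_).of_eq rfl ?_).mono ?_
  · intro x m o
    refine (Exec.seq (D.exec_prog hD (mem_iff_envPair x)) (t' :=
      ((D'.time + E.time + 20) * (X + 1) ^ 2 + 10 : Polynomial ℕ).eval G.n) ?_).mono
        (by simp; omega)
    by_cases h : Fml.Sat G (envPair x) D
    · rw [if_pos h]
      refine (exec_ite_base_pos h ((exec_setFlag_base _).seq ((inner x m o).seq
        (exec_writeWord_base [none])))).of_eq rfl ?_ |>.mono ?_
      · simp [envPair]
      · simp
        omega
    · rw [if_neg h]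
      exact (exec_ite_base_neg h (Exec.skip _)).mono (by simp)
  · simp only [flatMap_ite, List.map_const', List.sum_replicate, smul_zero, add_zero]
    rfl
  · simp only [eval_mul, eval_add, eval_pow, eval_X, eval_one, eval_ofNat]
    gcongr ?_ * _
    omega

/-- Write the adjacency matrix of the graph on the pairs satisfying `D`, with edges given by `E`,
if `Φ` holds and there are not more pairs than vertices. Write the word `w` otherwise. -/
noncomputable def interpret (Φ D D' E : Fml) (w : List (Option Bool)) : Prog :=
  seq init (seq (checkPairs Φ D) (seq (ite (seq (setFlag false) (writeMatrix D D' E))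
    (writeWord w)) (clear (Finset.univ.erase (Sum.inl Tape.out)).toList)))

theorem exec_interpret {Φ D D' E : Fml} (hΦ : Φ.Admissible ∅) (hD : D.Admissible {0, 1})
    (hD' : D'.Admissible {0, 1, 2, 3}) (hE : E.Admissible {0, 1, 2, 3})
    (hDD' : ∀ (G : FinGraph) (x y : Fin G.n × Fin G.n),
      Fml.Sat G (envQuad x y) D' ↔ Fml.Sat G (envPair y) D) (w : List (Option Bool)) :
    ∃ p : Polynomial ℕ, ∀ G : FinGraph, ∃ f, Exec (interpret Φ D D' E w)
      ⟨false, Function.update (fun _ => []) (Sum.inl .mat) G.encode⟩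
      ⟨f, Function.update (fun _ => []) (Sum.inl .out)
        (if Fml.Sat G (fun _ => none) Φ ∧ (pairs D G).length ≤ G.n then matrixWord D E G
          else w).reverse⟩ (p.eval G.encode.length) := by
  let ks : List (Tape ⊕ Ctr) := (Finset.univ.erase (Sum.inl Tape.out)).toList
  refine ⟨(13 * X + 2) + ((Φ.time + (D.time + 13) * (X + 1) ^ 2 + 8 * X + 13) +
    (((D.time + (D'.time + E.time + 20) * (X + 1) ^ 2 + 20) * (X + 1) ^ 2 + (w.length : ℕ[X]) + 2)
      + ((ks.length : ℕ[X]) * (2 * (X + 1) ^ 2 + 1) + 1))), fun G => ?_⟩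
  -- All later bounds are polynomials in the number of vertices; monotonicity turns them into bounds
  -- in the input length.
  have hn : G.n ≤ G.encode.length := by
    rw [G.length_encode]
    nlinarith
  obtain ⟨m, hm, hcheck⟩ := exec_checkPairs (G := G) (o := []) (f := false) hΦ hD
  have hclear : ∀ (v : List (Option Bool)) (f : Bool),
      Exec (clear ks) (base (G := G) (fun _ => none) m v f)
        ⟨f, Function.update (fun _ => []) (Sum.inl .out) v⟩
        (((ks.length : ℕ[X]) * (2 * (X + 1) ^ 2 + 1) + 1 : ℕ[X]).eval G.n) := by
    intro v f
    refine ((exec_clear f _ ((G.n + 1) ^ 2) ks ?_).of_eq rfl ?_).mono ?_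
    · intro k hk
      rcases k with k | k
      · cases k
        · simp only [Sum.elim_inl, tapesAt, List.drop_zero, G.length_encode]
          nlinarith
        · simp [tapesAt]
        · simp [ks] at hk
      · simp only [Sum.elim_inr, List.length_replicate]
        cases k <;> simp only [ctrs, Option.elim] <;> nlinarith
    · congr 1
      funext k
      by_cases hk : k = Sum.inl .out
      · subst hk
        simp [ks, tapesAt]
      · simp [ks, hk]
    · simp
  have hwrite : ∃ f, Exec (ite (seq (setFlag false) (writeMatrix D D' E)) (writeWord w))
      (base (G := G) (fun _ => none) m []
        (decide (Fml.Sat G (fun _ => none) Φ ∧ (pairs D G).length ≤ G.n)))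
      (base (G := G) (fun _ => none) m
        (if Fml.Sat G (fun _ => none) Φ ∧ (pairs D G).length ≤ G.n then matrixWord D E G
          else w).reverse f)
      (((D.time + (D'.time + E.time + 20) * (X + 1) ^ 2 + 20) * (X + 1) ^ 2 + (w.length : ℕ[X]) + 2
        : ℕ[X]).eval G.n) := by
    refine ⟨false, ?_⟩
    by_cases h : Fml.Sat G (fun _ => none) Φ ∧ (pairs D G).length ≤ G.n
    · rw [if_pos h]
      refine (exec_ite_base_pos h ((exec_setFlag_base _).seq
        ((exec_writeMatrix hD hD' hE (hDD' G)).of_eq rfl (by rw [List.append_nil])))).mono ?_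
      simp only [eval_add, eval_natCast, eval_ofNat, Nat.cast_id]
      omega
    · rw [if_neg h]
      refine (exec_ite_base_neg h ((exec_writeWord_base w).of_eq rfl
        (by rw [List.append_nil]))).mono ?_
      simp only [eval_add, eval_natCast, eval_ofNat, Nat.cast_id]
      omega
  obtain ⟨f, hwrite⟩ := hwrite
  refine ⟨f, ((exec_init G).seq (hcheck.seq (hwrite.seq (hclear _ f)))).mono ?_⟩
  rw [eval_add (p := 13 * X + 2), eval_add (p := Φ.time + _ + _ + _)]
  refine add_le_add (by simp) (add_le_add (eval_nat_mono _ hn) ?_)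
  rw [eval_add (q := _ * _ + 1)]
  exact add_le_add (eval_nat_mono _ hn) (eval_nat_mono _ hn)
end
end StackProg

/-! ### The Helly property. -/

/-- Helly property: without a triangle of three partially overlapping members, a set all of whose
pairs lie in a member of a family lies in a member of the family. -/
theorem exists_cover_of_pairs {ι V : Type*} [Finite ι] {M : ι → V → Prop}
    (hM : ∀ i j k c c' c'', M c i → M c j → ¬ M c k → M c' i → M c' k → ¬ M c' j →
      M c'' j → M c'' k → ¬ M c'' i → False)
    {P : ι → Prop} {Q : Finset V} (hQ : Q.Nonempty)
    (h : ∀ j ∈ Q, ∀ k ∈ Q, ∃ c, P c ∧ M c j ∧ M c k) : ∃ c, P c ∧ ∀ q ∈ Q, M c q := by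
  classical
  by_contra! hcon
  obtain ⟨q, hq⟩ := hQ
  obtain ⟨c₀, hc₀, -⟩ := h q hq q hq
  have : Nonempty {c // P c} := ⟨⟨c₀, hc₀⟩⟩
  -- Choose a member covering as much of `Q` as possible, and a point `k` that it misses.
  obtain ⟨⟨c, hc⟩, hmax⟩ := Finite.exists_max fun c : {c // P c} => (Q.filter (M c)).card
  obtain ⟨k, hk, hck⟩ := hcon c hc
  obtain ⟨c₁, hc₁, hc₁k, -⟩ := h k hk k hk
  have : Nonempty {c // P c ∧ M c k} := ⟨⟨c₁, hc₁, hc₁k⟩⟩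
  -- Among the members containing `k`, choose one that shares as much of `Q` as possible with `c`.
  obtain ⟨⟨c', hc', hc'k⟩, hmax'⟩ := Finite.exists_max fun x : {x // P x ∧ M x k} =>
    (Q.filter fun v => M x v ∧ M c v).card
  -- Otherwise `c'` would cover everything that `c` covers, and `k` in addition.
  obtain ⟨j, hj, hcj, hc'j⟩ : ∃ j ∈ Q, M c j ∧ ¬ M c' j := by
    by_contra! hno
    refine (hmax ⟨c', hc'⟩).not_gt (Finset.card_lt_card (Finset.ssubset_iff_subset_ne.2 ⟨?_, ?_⟩))
    · intro v hv
      simp only [Finset.mem_filter] at hv ⊢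
      exact ⟨hv.1, hno v hv.1 hv.2⟩
    · intro he
      have : k ∈ Q.filter (M c') := by simp [hk, hc'k]
      rw [← he] at this
      simp [hck] at this
  obtain ⟨c'', hc'', hc''j, hc''k⟩ := h j hj k hk
  -- Otherwise `c''` would share with `c` everything that `c'` does, and `j` in addition. The points
  -- `i`, `j`, `k` now form the forbidden triangle.
  obtain ⟨i, hi, hc'i, hci, hc''i⟩ : ∃ i ∈ Q, M c' i ∧ M c i ∧ ¬ M c'' i := by
    by_contra! hno
    refine (hmax' ⟨c'', hc'', hc''k⟩).not_gt
      (Finset.card_lt_card (Finset.ssubset_iff_subset_ne.2 ⟨?_, ?_⟩))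
    · intro v hv
      simp only [Finset.mem_filter] at hv ⊢
      exact ⟨hv.1, hno v hv.1 hv.2.1 hv.2.2, hv.2.2⟩
    · intro he
      have : j ∈ Q.filter fun v => M c'' v ∧ M c v := by simp [hj, hc''j, hcj]
      rw [← he] at this
      simp [hc'j] at this
  exact hM i j k c c' c'' hci hcj hck hc'i hc'k hc'j hc''j hc''k hc''i

/-! ### Generated cliques, the skeleton and its square. -/

namespace SimpleGraph

variable {V W : Type*} {G H : SimpleGraph V}

theorem square_adj {u v : V} :
    G.square.Adj u v ↔ u ≠ v ∧ (G.Adj u v ∨ ∃ w, G.Adj u w ∧ G.Adj w v) := by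
  refine and_congr_right fun huv => ⟨fun h => ?_, fun h => ?_⟩
  · have hr : G.Reachable u v := by
      rw [← edist_ne_top_iff_reachable]
      intro he
      rw [he] at h
      simp at h
    obtain ⟨p, hp⟩ := hr.exists_walk_length_eq_edist
    rw [← hp] at h
    have hl : p.length ≤ 2 := by exact_mod_cast h
    cases p with
    | nil => exact absurd rfl huv
    | cons h1 p =>
      cases p with
      | nil => exact Or.inl h1
      | cons h2 p =>
        cases p with
        | nil => exact Or.inr ⟨_, h1, h2⟩
        | cons h3 p => simp at hl
  · rcases h with h | ⟨w, h1, h2⟩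
    · exact (edist_le (Walk.cons h Walk.nil)).trans (by simp)
    · exact (edist_le (Walk.cons h1 (Walk.cons h2 Walk.nil))).trans (by simp)

theorem le_square : G ≤ G.square := fun _ _ h => square_adj.2 ⟨h.ne, Or.inl h⟩

theorem connected_square : G.square.Connected ↔ G.Connected := by
  refine ⟨fun h => ?_, fun h => h.mono le_square⟩
  have := h.nonempty
  refine ⟨fun u v => ?_⟩
  obtain ⟨p⟩ := h.preconnected u v
  induction p with
  | nil => exact Reachable.refl _
  | cons h1 _ ih =>
    refine Reachable.trans ?_ ih
    rcases (square_adj.1 h1).2 with h2 | ⟨w, h2, h3⟩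
    · exact h2.reachable
    · exact h2.reachable.trans h3.reachable

/-- The square of an isomorphic graph. -/
def Iso.square {G : SimpleGraph V} {F : SimpleGraph W} (φ : G ≃g F) : G.square ≃g F.square where
  toEquiv := φ.toEquiv
  map_rel_iff' {a b} := by
    simp only [square_adj]
    refine and_congr (by simp) (or_congr φ.map_adj_iff ⟨?_, ?_⟩)
    · rintro ⟨w, h1, h2⟩
      obtain ⟨x, rfl⟩ := φ.surjective w
      exact ⟨x, φ.map_adj_iff.1 h1, φ.map_adj_iff.1 h2⟩
    · rintro ⟨w, h1, h2⟩
      exact ⟨φ w, φ.map_adj_iff.2 h1, φ.map_adj_iff.2 h2⟩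

variable (G)

/-- Two vertices are near when they are equal or adjacent. -/
def Near (u v : V) : Prop := u = v ∨ G.Adj u v

/-- The vertex `w` is near to both `u` and `v`. -/
def Common (u v w : V) : Prop := G.Near u w ∧ G.Near v w

/-- The pair `u, v` generates a clique when `u` and `v` are near to each other and the vertices that
are near to both form a clique. -/
def Generates (u v : V) : Prop :=
  G.Near u v ∧ ∀ a b, G.Common u v a → G.Common u v b → G.Near a b

/-- Any two near vertices are contained in a clique generated by some pair. -/
def Covered : Prop :=
  ∀ u v, G.Near u v → ∃ a b, G.Generates a b ∧ G.Common a b u ∧ G.Common a b v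

variable {G}

theorem Near.symm {u v : V} (h : G.Near u v) : G.Near v u :=
  h.imp Eq.symm Adj.symm

theorem Near.refl (u : V) : G.Near u u := Or.inl rfl

theorem Generates.common_left {u v : V} (h : G.Generates u v) : G.Common u v u :=
  ⟨Near.refl u, h.1.symm⟩

section LinearOrder

variable [LinearOrder V]

variable (G) in
/-- The lexicographically first pair that generates its clique. -/
def Canonical (u v : V) : Prop :=
  G.Generates u v ∧ ¬ ∃ a b, (a < u ∨ (a = u ∧ b < v)) ∧ G.Generates a b ∧
    ∀ w, G.Common a b w ↔ G.Common u v w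

variable (G) in
/-- The first vertex that is not near to `u` is `v`. -/
def FirstFar (u v : V) : Prop := ¬ G.Near u v ∧ ¬ ∃ w, w < v ∧ ¬ G.Near u w

variable (G) in
/-- The pairs that represent the generated cliques and the vertices that are not universal. -/
def IsSkeletonVertex (p : V × V) : Prop := G.Canonical p.1 p.2 ∨ G.FirstFar p.1 p.2

variable (G) in
/-- The incidence graph between the generated cliques and the vertices that are not universal,
where the cliques are adjacent to each other. -/
def pairGraph : SimpleGraph (V × V) where
  Adj p q := (G.Near p.1 p.2 ∧ G.Near q.1 q.2 ∧ p ≠ q) ∨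
    (G.Near p.1 p.2 ∧ ¬ G.Near q.1 q.2 ∧ G.Common p.1 p.2 q.1) ∨
    (¬ G.Near p.1 p.2 ∧ G.Near q.1 q.2 ∧ G.Common q.1 q.2 p.1)
  symm := ⟨by
    rintro p q (⟨h1, h2, h3⟩ | ⟨h1, h2, h3⟩ | ⟨h1, h2, h3⟩)
    · exact Or.inl ⟨h2, h1, h3.symm⟩
    · exact Or.inr (Or.inr ⟨h2, h1, h3⟩)
    · exact Or.inr (Or.inl ⟨h2, h1, h3⟩)⟩
  loopless := ⟨by
    rintro p (⟨_, _, h3⟩ | ⟨h1, h2, _⟩ | ⟨h1, h2, _⟩)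
    · exact h3 rfl
    · exact h2 h1
    · exact h1 h2⟩

variable (G) in
/-- The incidence graph between the generated cliques and the vertices that are not universal, on
its proper vertex set. -/
def skeleton : SimpleGraph {p // G.IsSkeletonVertex p} := G.pairGraph.comap Subtype.val

/-- Each generated clique is represented by one pair only; otherwise the skeleton could have more
hubs than the square root has clique vertices. -/
theorem Canonical.eq {a b u v : V} (h : G.Canonical a b) (h' : G.Canonical u v)
    (hc : ∀ w, G.Common a b w ↔ G.Common u v w) : (a, b) = (u, v) := by
  rcases lt_trichotomy a u with hau | rfl | hau
  · exact absurd ⟨a, b, Or.inl hau, h.1, hc⟩ h'.2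
  · rcases lt_trichotomy b v with hbv | rfl | hbv
    · exact absurd ⟨a, b, Or.inr ⟨rfl, hbv⟩, h.1, hc⟩ h'.2
    · rfl
    · exact absurd ⟨a, v, Or.inr ⟨rfl, hbv⟩, h'.1, fun w => (hc w).symm⟩ h.2
  · exact absurd ⟨u, v, Or.inl hau, h'.1, fun w => (hc w).symm⟩ h.2

theorem FirstFar.eq {u v w : V} (h : G.FirstFar u v) (h' : G.FirstFar u w) : v = w := by
  by_contra hne
  rcases lt_or_gt_of_ne hne with hlt | hlt
  · exact h'.2 ⟨v, hlt, h.1⟩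
  · exact h.2 ⟨w, hlt, h'.1⟩

theorem exists_firstFar [Finite V] {u : V} (h : ∃ v, ¬ G.Near u v) : ∃ v, G.FirstFar u v := by
  obtain ⟨v, hv, hmin⟩ := WellFounded.has_min (wellFounded_lt (α := V)) {v | ¬ G.Near u v} h
  exact ⟨v, hv, fun ⟨w, hw, hw'⟩ => hmin w hw' hw⟩

theorem Generates.exists_canonical [Finite V] {u v : V} (h : G.Generates u v) :
    ∃ a b, G.Canonical a b ∧ ∀ w, G.Common a b w ↔ G.Common u v w := by
  obtain ⟨a, ⟨b₀, hb₀⟩, ha⟩ := WellFounded.has_min (wellFounded_lt (α := V))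
    {a | ∃ b, G.Generates a b ∧ ∀ w, G.Common a b w ↔ G.Common u v w}
    ⟨u, v, h, fun _ => Iff.rfl⟩
  obtain ⟨b, hb, hmin⟩ := WellFounded.has_min (wellFounded_lt (α := V))
    {b | G.Generates a b ∧ ∀ w, G.Common a b w ↔ G.Common u v w} ⟨b₀, hb₀⟩
  refine ⟨a, b, ⟨hb.1, ?_⟩, hb.2⟩
  rintro ⟨x, y, hxy | ⟨rfl, hxy⟩, hg, hc⟩
  · exact ha x ⟨y, hg, fun w => (hc w).trans (hb.2 w)⟩ hxy
  · exact hmin y ⟨hg, fun w => (hc w).trans (hb.2 w)⟩ hxy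

end LinearOrder

/-- A graph `F` arises from `G` by changing the number of universal vertices. -/
def Matches (G : SimpleGraph V) (F : SimpleGraph W) : Prop :=
  ∃ φ : V → W, Set.InjOn φ {u | ∃ v, ¬ G.Near u v} ∧
    (∀ u v, (∃ w, ¬ G.Near u w) → (∃ w, ¬ G.Near v w) → (F.Adj (φ u) (φ v) ↔ G.Adj u v)) ∧
    ∀ w, w ∉ φ '' {u | ∃ v, ¬ G.Near u v} → ∀ w', w ≠ w' → F.Adj w w'

theorem Matches.trans_iso {X : Type*} {G : SimpleGraph V} {F : SimpleGraph W} {F' : SimpleGraph X}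
    (h : G.Matches F) (ψ : F ≃g F') : G.Matches F' := by
  obtain ⟨φ, hinj, hadj, huniv⟩ := h
  refine ⟨ψ ∘ φ, ψ.injective.comp_injOn hinj, fun u v hu hv => ?_, fun w hw w' hww' => ?_⟩
  · rw [← hadj u v hu hv]
    exact ψ.map_adj_iff
  · obtain ⟨x, rfl⟩ := ψ.surjective w
    obtain ⟨x', rfl⟩ := ψ.surjective w'
    refine ψ.map_adj_iff.2 (huniv x ?_ x' fun h => hww' (congrArg ψ h))
    rintro ⟨u, hu, rfl⟩
    exact hw ⟨u, hu, rfl⟩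

theorem Matches.join {G : SimpleGraph V} {F : SimpleGraph W} (h : G.Matches F) :
    G.Matches (F.join (⊤ : SimpleGraph (Fin 1))) := by
  obtain ⟨φ, hinj, hadj, huniv⟩ := h
  refine ⟨Sum.inl ∘ φ, Sum.inl_injective.comp_injOn hinj, fun u v hu hv => ?_,
    fun w hw w' hww' => ?_⟩
  · rw [← hadj u v hu hv]
    simp [SimpleGraph.join]
  · rcases w with w | w <;> rcases w' with w' | w'
    · have := huniv w (by
        rintro ⟨u, hu, rfl⟩
        exact hw ⟨u, hu, rfl⟩) w' (fun h => hww' (congrArg _ h))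
      simpa [SimpleGraph.join] using this
    · simp [SimpleGraph.join]
    · simp [SimpleGraph.join]
    · exact absurd (congrArg Sum.inr (Subsingleton.elim w w')) hww'

/-- The map on the non-universal vertices extends to a bijection because the cardinalities agree,
and any extension works: the remaining vertices are universal on both sides. -/
theorem Matches.nonempty_iso [Fintype V] [Fintype W] {G : SimpleGraph V} {F : SimpleGraph W}
    (h : G.Matches F) (hc : Fintype.card V = Fintype.card W) : Nonempty (G ≃g F) := by
  classical
  obtain ⟨φ, hinj, hadj, huniv⟩ := h
  obtain ⟨g, hg⟩ := Finset.exists_equiv_extend_of_card_eq (t := (Finset.univ : Finset W))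
    (by rw [hc, Finset.card_univ]) (s := Finset.univ.filter fun u => ∃ v, ¬ G.Near u v) (f := φ)
    (by simp) (by simpa using hinj)
  let ψ : V ≃ W := g.trans (Equiv.subtypeUnivEquiv fun _ => Finset.mem_univ _)
  have hψ : ∀ u, (∃ v, ¬ G.Near u v) → ψ u = φ u := fun u hu => hg u (by simpa using hu)
  have huniv' : ∀ u v, (¬ ∃ w, ¬ G.Near u w) → (F.Adj (ψ u) (ψ v) ↔ G.Adj u v) := by
    intro u v hu
    have h1 : ψ u ∉ φ '' {u | ∃ v, ¬ G.Near u v} := by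
      rintro ⟨x, hx, he⟩
      rw [← hψ x hx] at he
      exact hu (ψ.injective he ▸ hx)
    by_cases huv : u = v
    · subst huv; simp
    · push Not at hu
      exact ⟨fun _ => (hu v).resolve_left huv,
        fun _ => huniv _ h1 _ fun h => huv (ψ.injective h)⟩
  refine ⟨⟨ψ, fun {u v} => ?_⟩⟩
  by_cases hu : ∃ w, ¬ G.Near u w
  · by_cases hv : ∃ w, ¬ G.Near v w
    · rw [hψ u hu, hψ v hv]
      exact hadj u v hu hv
    · rw [F.adj_comm, G.adj_comm]
      exact huniv' v u hv
  · exact huniv' u v hu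

section LinearOrder

variable [LinearOrder V]

theorem skeleton_adj_of_near {p q : {p // G.IsSkeletonVertex p}} (hp : G.Near p.1.1 p.1.2)
    (hq : G.Near q.1.1 q.1.2) (hpq : p ≠ q) : G.skeleton.Adj p q :=
  Or.inl ⟨hp, hq, fun h => hpq (Subtype.ext h)⟩

theorem Covered.exists_hub [Finite V] (hG : G.Covered) {u v : V} (huv : G.Near u v) :
    ∃ p : {p // G.IsSkeletonVertex p}, G.Canonical p.1.1 p.1.2 ∧ G.Common p.1.1 p.1.2 u ∧
      G.Common p.1.1 p.1.2 v := by
  obtain ⟨a, b, hab, hu, hv⟩ := hG u v huv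
  obtain ⟨x, y, hxy, hc⟩ := hab.exists_canonical
  exact ⟨⟨(x, y), Or.inl hxy⟩, hxy, (hc u).2 hu, (hc v).2 hv⟩

/-- Hubs are universal in the square: they are adjacent to each other, and every leaf is adjacent to
some hub because its vertex lies in a generated clique. -/
theorem Covered.square_adj_hub [Finite V] (hG : G.Covered) {p q : {p // G.IsSkeletonVertex p}}
    (hp : G.Near p.1.1 p.1.2) (hpq : p ≠ q) : G.skeleton.square.Adj p q := by
  rw [square_adj]
  refine ⟨hpq, ?_⟩
  by_cases hq : G.Near q.1.1 q.1.2
  · exact Or.inl (skeleton_adj_of_near hp hq hpq)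
  · obtain ⟨r, hr, hrq, -⟩ := hG.exists_hub (Near.refl q.1.1)
    have h1 : G.skeleton.Adj r q := Or.inr (Or.inl ⟨hr.1.1, hq, hrq⟩)
    by_cases hpr : p = r
    · exact Or.inl (hpr ▸ h1)
    · exact Or.inr ⟨r, skeleton_adj_of_near hp hr.1.1 hpr, h1⟩

theorem Covered.connected_skeleton [Finite V] [Nonempty V] (hG : G.Covered) :
    G.skeleton.Connected := by
  obtain ⟨p, hp, -⟩ := hG.exists_hub (Near.refl (Classical.arbitrary V))
  rw [← connected_square]
  have h : ∀ q, G.skeleton.square.Reachable p q := by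
    intro q
    by_cases hpq : p = q
    · exact hpq ▸ Reachable.refl _
    · exact (hG.square_adj_hub hp.1.1 hpq).reachable
  have : Nonempty {p // G.IsSkeletonVertex p} := ⟨p⟩
  exact ⟨fun u v => (h u).symm.trans (h v)⟩

/-- Leaves are pairwise non-adjacent in the skeleton, so two of them are adjacent in the square
exactly when they share a hub. A shared hub is a clique containing both vertices, and covering
supplies one for every edge. All other vertices of the skeleton are hubs, hence universal. -/
theorem Covered.matches_skeleton [Finite V] [Nonempty V] (hG : G.Covered) :
    G.Matches G.skeleton.square := by
  classical
  obtain ⟨p₀, -⟩ := hG.exists_hub (Near.refl (Classical.arbitrary V))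
  -- The value `p₀` at universal vertices is arbitrary, since `Matches` ignores them.
  let φ : V → {p // G.IsSkeletonVertex p} := fun u =>
    if h : ∃ v, ¬ G.Near u v then ⟨(u, (exists_firstFar h).choose),
      Or.inr (exists_firstFar h).choose_spec⟩ else p₀
  have hφ : ∀ u, (∃ v, ¬ G.Near u v) → (φ u).1.1 = u ∧ ¬ G.Near (φ u).1.1 (φ u).1.2 := by
    intro u hu
    simp only [φ, dif_pos hu, true_and]
    exact (exists_firstFar hu).choose_spec.1
  have hinj : Set.InjOn φ {u | ∃ v, ¬ G.Near u v} := by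
    intro u hu v hv h
    rw [← (hφ u hu).1, ← (hφ v hv).1, h]
  refine ⟨φ, hinj, fun u v hu hv => ?_, fun w hw w' hww' => ?_⟩
  · obtain ⟨hu1, hu2⟩ := hφ u hu
    obtain ⟨hv1, hv2⟩ := hφ v hv
    rw [square_adj]
    constructor
    · rintro ⟨hne, h | ⟨r, h1, h2⟩⟩
      · rcases h with h | h | h
        · exact absurd h.1 hu2
        · exact absurd h.1 hu2
        · exact absurd h.2.1 hv2
      · have huv : u ≠ v := fun h => hne (congrArg φ h)
        have h1' : G.Near r.1.1 r.1.2 ∧ G.Common r.1.1 r.1.2 u := by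
          rcases h1 with h | h | h
          · exact absurd h.1 hu2
          · exact absurd h.1 hu2
          · exact ⟨h.2.1, hu1 ▸ h.2.2⟩
        have h2' : G.Common r.1.1 r.1.2 v := by
          rcases h2 with h | h | h
          · exact absurd h.2.1 hv2
          · exact hv1 ▸ h.2.2
          · exact absurd h.2.1 hv2
        have hr : G.Canonical r.1.1 r.1.2 := r.2.resolve_right fun h => h.1 h1'.1
        exact (hr.1.2 u v h1'.2 h2').resolve_left huv
    · intro h
      refine ⟨fun he => h.ne (hinj hu hv he), Or.inr ?_⟩
      obtain ⟨r, hr, hru, hrv⟩ := hG.exists_hub (Or.inr h)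
      exact ⟨r, Or.inr (Or.inr ⟨hu2, hr.1.1, by rwa [hu1]⟩),
        Or.inr (Or.inl ⟨hr.1.1, hv2, by rwa [hv1]⟩)⟩
  · refine hG.square_adj_hub ?_ hww'
    -- A pair that is not near is the leaf of its first entry, by uniqueness of the first far
    -- vertex, and so lies in the image.
    by_contra hfar
    have h1 := w.2.resolve_left fun h => hfar h.1.1
    refine hw ⟨w.1.1, ⟨_, hfar⟩, Subtype.ext (Prod.ext (hφ _ ⟨_, hfar⟩).1 ?_)⟩
    have h2 := (φ w.1.1).2.resolve_left fun h => (hφ _ ⟨_, hfar⟩).2 h.1.1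
    rw [(hφ _ ⟨_, hfar⟩).1] at h2
    exact h2.eq h1

end LinearOrder

end SimpleGraph

/-! ### Squares of split graphs without 3-sun. -/

namespace SimpleGraph

variable {V : Type*} {H : SimpleGraph V}

/-- By connectedness a vertex outside the clique has a neighbour, which cannot lie in the
independent set. -/
theorem IsSplitGraph.exists_dominating_clique (hH : H.IsSplitGraph) (hc : H.Connected) :
    ∃ C : Set V, H.IsClique C ∧ H.IsIndepSet Cᶜ ∧ C.Nonempty ∧ ∀ v ∉ C, ∃ c ∈ C, H.Adj c v := by
  have := hc.nonempty
  rcases subsingleton_or_nontrivial V with hV | hV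
  -- A single vertex has no neighbour, and the given clique might be empty.
  · exact ⟨Set.univ, Set.subsingleton_univ.pairwise _, by simp, Set.univ_nonempty, by simp⟩
  · obtain ⟨C, hC, hI⟩ := hH
    have hnbr : ∀ v ∉ C, ∃ c ∈ C, H.Adj c v := by
      intro v hv
      obtain ⟨u, hu⟩ := hc.preconnected.exists_adj_of_nontrivial v
      refine ⟨u, ?_, hu.symm⟩
      by_contra huC
      exact hI hv huC hu.ne hu
    refine ⟨C, hC, hI, ?_, hnbr⟩
    by_cases h : Classical.arbitrary V ∈ C
    · exact ⟨_, h⟩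
    · obtain ⟨c, hc, -⟩ := hnbr _ h
      exact ⟨c, hc⟩

/-- A vertex of `C` that is near to `v`. -/
def NearFrom (H : SimpleGraph V) (C : Set V) (c v : V) : Prop := c ∈ C ∧ H.Near c v

section

variable {C : Set V} (hC : H.IsClique C) (hI : H.IsIndepSet Cᶜ) (hne : C.Nonempty)
  (hdom : ∀ v ∉ C, ∃ c ∈ C, H.Adj c v)

include hC in
theorem nearFrom_of_mem {c v : V} (hc : c ∈ C) (hv : v ∈ C) : H.NearFrom C c v := by
  by_cases h : c = v
  · exact ⟨hc, Or.inl h⟩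
  · exact ⟨hc, Or.inr (hC hc hv h)⟩

include hC hne hdom in
theorem exists_nearFrom (v : V) : ∃ c, H.NearFrom C c v := by
  by_cases hv : v ∈ C
  · obtain ⟨c, hc⟩ := hne
    exact ⟨c, nearFrom_of_mem hC hc hv⟩
  · obtain ⟨c, hc, h⟩ := hdom v hv
    exact ⟨c, hc, Or.inr h⟩

-- Between two independent vertices a path of length two has its middle in `C`. If one of the
-- vertices is in `C`, any element of `C` near to the other one serves, since `C` is a clique.
include hC hI hne hdom in
theorem near_square_iff {u v : V} :
    H.square.Near u v ↔ ∃ c, H.NearFrom C c u ∧ H.NearFrom C c v := by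
  constructor
  · intro h
    by_cases hu : u ∈ C
    · obtain ⟨c, hc⟩ := exists_nearFrom hC hne hdom v
      exact ⟨c, nearFrom_of_mem hC hc.1 hu, hc⟩
    · by_cases hv : v ∈ C
      · obtain ⟨c, hc⟩ := exists_nearFrom hC hne hdom u
        exact ⟨c, hc, nearFrom_of_mem hC hc.1 hv⟩
      · rcases h with rfl | h
        · obtain ⟨c, hc⟩ := exists_nearFrom hC hne hdom u
          exact ⟨c, hc, hc⟩
        · obtain ⟨huv, h | ⟨w, h1, h2⟩⟩ := square_adj.1 h
          · exact absurd h (hI hu hv huv)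
          · have hw : w ∈ C := by
              by_contra hw
              exact hI hu hw h1.ne h1
            exact ⟨w, ⟨hw, Or.inr h1.symm⟩, hw, Or.inr h2⟩
  · rintro ⟨c, ⟨-, h1⟩, -, h2⟩
    by_cases huv : u = v
    · exact Or.inl huv
    refine Or.inr (square_adj.2 ⟨huv, ?_⟩)
    rcases h1 with rfl | h1
    · exact Or.inl (h2.resolve_left huv)
    · rcases h2 with rfl | h2
      · exact Or.inl h1.symm
      · exact Or.inr ⟨c, h1.symm, h2⟩

-- Each of `i`, `j`, `k` is missed by one of the three clique vertices and hence lies outside `C`.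
-- The incidences then force all six vertices to be distinct and to induce a 3-sun.
include hC hI in
theorem IsThreeSunFree.not_triangle (hsun : H.IsThreeSunFree) (i j k c c' c'' : V)
    (hi : H.NearFrom C c i) (hj : H.NearFrom C c j) (hk : ¬ H.NearFrom C c k)
    (hi' : H.NearFrom C c' i) (hk' : H.NearFrom C c' k) (hj' : ¬ H.NearFrom C c' j)
    (hj'' : H.NearFrom C c'' j) (hk'' : H.NearFrom C c'' k) (hi'' : ¬ H.NearFrom C c'' i) :
    False := by
  have hmem : ∀ {x v}, x ∈ C → ¬ H.NearFrom C x v → v ∉ C := fun hx h hv =>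
    h (nearFrom_of_mem hC hx hv)
  have hadj : ∀ {x v}, v ∉ C → H.NearFrom C x v → H.Adj x v := fun hv h =>
    h.2.resolve_left fun he => hv (he ▸ h.1)
  have hnadj : ∀ {x v}, x ∈ C → ¬ H.NearFrom C x v → ¬ H.Adj x v := fun hx h ha =>
    h ⟨hx, Or.inr ha⟩
  have hkC := hmem hi.1 hk
  have hjC := hmem hi'.1 hj'
  have hiC := hmem hj''.1 hi''
  have e1 := hadj hiC hi
  have e2 := hadj hjC hj
  have e3 := hnadj hi.1 hk
  have e4 := hadj hiC hi'
  have e5 := hadj hkC hk'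
  have e6 := hnadj hi'.1 hj'
  have e7 := hadj hjC hj''
  have e8 := hadj hkC hk''
  have e9 := hnadj hj''.1 hi''
  have n1 : c ≠ c' := fun h => e6 (h ▸ e2)
  have n2 : c ≠ c'' := fun h => e9 (h ▸ e1)
  have n3 : c' ≠ c'' := fun h => e9 (h ▸ e4)
  have m1 : i ≠ j := fun h => e9 (h ▸ e7)
  have m2 : i ≠ k := fun h => e3 (h ▸ e1)
  have m3 : j ≠ k := fun h => e3 (h ▸ e2)
  have a1 := hC hi.1 hi'.1 n1
  have a2 := hC hi.1 hj''.1 n2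
  have a3 := hC hi'.1 hj''.1 n3
  have b1 : ¬ H.Adj i j := hI hiC hjC m1
  have b2 : ¬ H.Adj i k := hI hiC hkC m2
  have b3 : ¬ H.Adj j k := hI hjC hkC m3
  have x1 : ∀ {x y}, x ∈ C → y ∉ C → x ≠ y := fun hx hy h => hy (h ▸ hx)
  -- The order of the clique vertices is dictated by the cyclic indexing: `i` sees `c'` and `c`, `j`
  -- sees `c` and `c''`, `k` sees `c''` and `c'`.
  refine hsun ⟨⟨⟨Sum.elim ![i, j, k] ![c', c, c''], ?_⟩, ?_⟩⟩
  · rintro (x | x) (y | y) h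
    · fin_cases x <;> fin_cases y <;> simp_all
    · refine absurd h.symm (x1 ?_ ?_)
      · fin_cases y <;> simp [hi.1, hi'.1, hj''.1]
      · fin_cases x <;> simp [hiC, hjC, hkC]
    · refine absurd h (x1 ?_ ?_)
      · fin_cases x <;> simp [hi.1, hi'.1, hj''.1]
      · fin_cases y <;> simp [hiC, hjC, hkC]
    · fin_cases x <;> fin_cases y <;> simp_all
  · have hlr : ∀ x y, H.Adj (![i, j, k] x) (![c', c, c''] y) ↔ y = x ∨ y = x + 1 := by
      intro x y
      rw [H.adj_comm]
      fin_cases x <;> fin_cases y <;> simp [e1, e2, e3, e4, e5, e6, e7, e8, e9]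
    rintro (x | x) (y | y)
    · change H.Adj (![i, j, k] x) (![i, j, k] y) ↔ False
      fin_cases x <;> fin_cases y <;> simp [b1, b2, b3, H.adj_comm j i, H.adj_comm k]
    · exact hlr x y
    · rw [threeSun.adj_comm, H.adj_comm]
      exact hlr y x
    · change H.Adj (![c', c, c''] x) (![c', c, c''] y) ↔ x ≠ y
      fin_cases x <;> fin_cases y <;> simp [a1, a2, a3, a1.symm, a2.symm, a3.symm]

end

variable [Finite V]

/-- Take a largest N[c] containing `u` and `v`. If no pair in it generated it, every pair in N[c]
would lie in some N[c'] that does not contain N[c], and Helly applied to those sets would produce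
one that does. -/
theorem covered_square (hsplit : H.IsSplitGraph) (hsun : H.IsThreeSunFree) (hc : H.Connected) :
    H.square.Covered := by
  classical
  have := Fintype.ofFinite V
  obtain ⟨C, hC, hI, hne, hdom⟩ := hsplit.exists_dominating_clique hc
  have key := fun u v => near_square_iff (u := u) (v := v) hC hI hne hdom
  have htri := hsun.not_triangle hC hI
  intro u v huv
  obtain ⟨c₀, hu₀, hv₀⟩ := (key u v).1 huv
  have : Nonempty {c // H.NearFrom C c u ∧ H.NearFrom C c v} := ⟨⟨c₀, hu₀, hv₀⟩⟩
  obtain ⟨⟨c, hcu, hcv⟩, hmax⟩ := Finite.exists_max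
    fun x : {c // H.NearFrom C c u ∧ H.NearFrom C c v} =>
      (Finset.univ.filter (H.NearFrom C x)).card
  obtain ⟨i, j, hi, hj, hij⟩ : ∃ i j, H.NearFrom C c i ∧ H.NearFrom C c j ∧
      ∀ x, H.square.Common i j x → H.NearFrom C c x := by
    by_contra! hcon
    obtain ⟨c', hc', hc''⟩ := exists_cover_of_pairs htri
      (P := fun x => ¬ ∀ q, H.NearFrom C c q → H.NearFrom C x q)
      (Q := Finset.univ.filter (H.NearFrom C c)) ⟨u, by simpa using hcu⟩ (by
        intro j hj k hk
        simp only [Finset.mem_filter, Finset.mem_univ, true_and] at hj hk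
        obtain ⟨x, ⟨hjx, hkx⟩, hx⟩ := hcon j k hj hk
        obtain ⟨c₁, h1j, h1x⟩ := (key j x).1 hjx
        obtain ⟨c₂, h2k, h2x⟩ := (key k x).1 hkx
        -- The points `j`, `k`, `x` are pairwise covered by `c`, `c₁`, `c₂`; without a triangle a
        -- single neighbourhood contains all three.
        have hall : ∃ c', H.NearFrom C c' j ∧ H.NearFrom C c' k ∧ H.NearFrom C c' x := by
          by_contra! hno
          exact htri j k x c c₁ c₂ hj hk hx h1j h1x (fun h => hno c₁ h1j h h1x) h2k h2x
            (fun h => hno c₂ h h2k h2x)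
        obtain ⟨c', h1, h2, h3⟩ := hall
        refine ⟨c', fun hsub => ?_, h1, h2⟩
        -- If N[c'] contained N[c], the point `x` would make it strictly larger, against the choice
        -- of `c`.
        refine (hmax ⟨c', hsub u hcu, hsub v hcv⟩).not_gt (Finset.card_lt_card
          (Finset.ssubset_iff_of_subset ?_ |>.2 ⟨x, by simpa using h3, by simpa using hx⟩))
        intro q hq
        simp only [Finset.mem_filter, Finset.mem_univ, true_and] at hq ⊢
        exact hsub q hq)
    exact hc' fun q hq => hc'' q (by simpa using hq)
  refine ⟨i, j, ⟨(key i j).2 ⟨c, hi, hj⟩, fun a b ha hb => (key a b).2 ⟨c, hij a ha, hij b hb⟩⟩,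
    ⟨(key i u).2 ⟨c, hi, hcu⟩, (key j u).2 ⟨c, hj, hcu⟩⟩,
    ⟨(key i v).2 ⟨c, hi, hcv⟩, (key j v).2 ⟨c, hj, hcv⟩⟩⟩

/-- A generated clique goes to some c in `C` with that closed neighbourhood, and a leaf goes to its
own vertex, which is outside `C`. Distinct canonical pairs have distinct neighbourhoods, so the map
is injective. -/
theorem skeleton_isIndContained [LinearOrder V] (hsplit : H.IsSplitGraph)
    (hsun : H.IsThreeSunFree) (hc : H.Connected) : H.square.skeleton ⊴ H := by
  classical
  have := Fintype.ofFinite V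
  obtain ⟨C, hC, hI, hne, hdom⟩ := hsplit.exists_dominating_clique hc
  have key := fun u v => near_square_iff (u := u) (v := v) hC hI hne hdom
  have htri := hsun.not_triangle hC hI
  have hgen : ∀ i j, H.square.Generates i j →
      ∃ c, c ∈ C ∧ ∀ x, H.square.Common i j x ↔ H.NearFrom C c x := by
    intro i j hij
    have hi := hij.common_left
    -- Helly puts the clique inside some N[c]. As `i` and `j` then belong to N[c], everything in
    -- N[c] is near to both, which is the reverse inclusion.
    obtain ⟨c, -, hcq⟩ := exists_cover_of_pairs htri (P := fun _ => True)
      (Q := Finset.univ.filter (H.square.Common i j)) ⟨i, by simpa using hi⟩ (by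
        intro a ha b hb
        simp only [Finset.mem_filter, Finset.mem_univ, true_and] at ha hb
        obtain ⟨c, h⟩ := (key a b).1 (hij.2 a b ha hb)
        exact ⟨c, trivial, h⟩)
    have hcq' : ∀ x, H.square.Common i j x → H.NearFrom C c x := fun x hx =>
      hcq x (by simpa using hx)
    have hj : H.square.Common i j j := ⟨hij.1, Near.refl j⟩
    exact ⟨c, (hcq' i hi).1, fun x => ⟨hcq' x, fun hx =>
      ⟨(key i x).2 ⟨c, hcq' i hi, hx⟩, (key j x).2 ⟨c, hcq' j hj, hx⟩⟩⟩⟩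
  -- Vertices of `C` are universal in the square.
  have hfar : ∀ {u v}, ¬ H.square.Near u v → u ∉ C := by
    intro u v huv hu
    obtain ⟨c, h⟩ := exists_nearFrom hC hne hdom v
    exact huv ((key u v).2 ⟨c, nearFrom_of_mem hC h.1 hu, h⟩)
  choose! hub hhub hcommon using hgen
  let φ : {p // H.square.IsSkeletonVertex p} → V := fun p =>
    if H.square.Near p.1.1 p.1.2 then hub p.1.1 p.1.2 else p.1.1
  have hcan : ∀ p : {p // H.square.IsSkeletonVertex p}, H.square.Near p.1.1 p.1.2 →
      H.square.Canonical p.1.1 p.1.2 := fun p hp => p.2.resolve_right fun h => h.1 hp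
  have hff : ∀ p : {p // H.square.IsSkeletonVertex p}, ¬ H.square.Near p.1.1 p.1.2 →
      H.square.FirstFar p.1.1 p.1.2 := fun p hp => p.2.resolve_left fun h => hp h.1.1
  have hhubs : ∀ p q : {p // H.square.IsSkeletonVertex p}, H.square.Near p.1.1 p.1.2 →
      H.square.Near q.1.1 q.1.2 → hub p.1.1 p.1.2 = hub q.1.1 q.1.2 → p = q := by
    intro p q hp hq h
    refine Subtype.ext ((hcan p hp).eq (hcan q hq) fun w => ?_)
    rw [hcommon _ _ (hcan p hp).1, hcommon _ _ (hcan q hq).1, h]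
  have hleaf : ∀ p q : {p // H.square.IsSkeletonVertex p}, H.square.Near p.1.1 p.1.2 →
      ¬ H.square.Near q.1.1 q.1.2 →
      (H.Adj (hub p.1.1 p.1.2) q.1.1 ↔ H.square.Common p.1.1 p.1.2 q.1.1) := by
    intro p q hp hq
    have hmem := hhub _ _ (hcan p hp).1
    rw [hcommon _ _ (hcan p hp).1]
    exact ⟨fun h => ⟨hmem, Or.inr h⟩, fun h => h.2.resolve_left fun he => hfar hq (he ▸ hmem)⟩
  refine ⟨⟨⟨φ, fun p q h => ?_⟩, fun {p q} => ?_⟩⟩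
  · by_cases hp : H.square.Near p.1.1 p.1.2 <;> by_cases hq : H.square.Near q.1.1 q.1.2 <;>
      simp only [φ, if_pos, if_neg, hp, hq, not_false_eq_true] at h
    · exact hhubs p q hp hq h
    · exact absurd (h ▸ hhub _ _ (hcan p hp).1) (hfar hq)
    · exact absurd (h ▸ hhub _ _ (hcan q hq).1) (hfar hp)
    · refine Subtype.ext (Prod.ext h ?_)
      exact (hff p hp).eq (h ▸ hff q hq)
  · change H.Adj (φ p) (φ q) ↔ H.square.pairGraph.Adj p.1 q.1
    by_cases hp : H.square.Near p.1.1 p.1.2 <;> by_cases hq : H.square.Near q.1.1 q.1.2 <;>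
      simp only [φ, if_pos, if_neg, hp, hq, not_false_eq_true, pairGraph, not_true_eq_false,
        true_and, false_and, false_or, or_false]
    · refine ⟨fun h he => h.ne ?_, fun h => ?_⟩
      · rw [he]
      · exact hC (hhub _ _ (hcan p hp).1) (hhub _ _ (hcan q hq).1) fun he =>
          h (congrArg Subtype.val (hhubs p q hp hq he))
    · exact hleaf p q hp hq
    · rw [H.adj_comm]
      exact hleaf q p hq hp
    · by_cases he : p.1.1 = q.1.1
      · simp [he]
      · simpa using hI (hfar hp) (hfar hq) he

end SimpleGraph

/-! ### The skeleton in first-order logic. -/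

namespace StackProg.Fml

/-- Disjunction. -/
def or (φ ψ : Fml) : Fml := not (and (not φ) (not ψ))

/-- Implication. -/
def imp (φ ψ : Fml) : Fml := not (and φ (not ψ))

/-- Equivalence. -/
def iff (φ ψ : Fml) : Fml := and (imp φ ψ) (imp ψ φ)

/-- Universal quantification. -/
def all (v : Fin 8) (φ : Fml) : Fml := not (ex v (not φ))

/-- Equality. -/
def eq (u v : Fin 8) : Fml := and (not (lt u v)) (not (lt v u))

/-- Being equal or adjacent. -/
def near (u v : Fin 8) : Fml := or (eq u v) (adj u v)

/-- The third vertex is near to the first two. -/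
def common (u v w : Fin 8) : Fml := and (near u w) (near v w)

/-- The two vertices generate a clique. -/
def generates (u v : Fin 8) : Fml :=
  and (near u v) (all 6 (all 7 (imp (common u v 6) (imp (common u v 7) (near 6 7)))))

/-- The two vertices are the first pair that generates its clique. -/
def canonical (u v : Fin 8) : Fml :=
  and (generates u v) (not (ex 4 (ex 5 (and (or (lt 4 u) (and (eq 4 u) (lt 5 v)))
    (and (generates 4 5) (all 6 (iff (common 4 5 6) (common u v 6))))))))

/-- The second vertex is the first one that is not near to the first vertex. -/
def firstFar (u v : Fin 8) : Fml :=
  and (not (near u v)) (not (ex 6 (and (lt 6 v) (not (near u 6)))))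

/-- The pair is a vertex of the skeleton. -/
def isSkeletonVertex (u v : Fin 8) : Fml := or (canonical u v) (firstFar u v)

/-- Adjacency in the skeleton. -/
def skeletonAdj : Fml :=
  or (and (near 0 1) (and (near 2 3) (not (and (eq 0 2) (eq 1 3)))))
    (or (and (near 0 1) (and (not (near 2 3)) (common 0 1 2)))
      (and (not (near 0 1)) (and (near 2 3) (common 2 3 0))))

/-- There is a vertex, and two near vertices always lie in a generated clique. -/
def covered : Fml :=
  and (ex 0 (not (adj 0 0))) (all 0 (all 1 (imp (near 0 1)
    (ex 2 (ex 3 (and (generates 2 3) (and (common 2 3 0) (common 2 3 1))))))))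

variable {G : FinGraph} {e : Env G.n}

theorem sat_not {φ : Fml} : Sat G e (not φ) ↔ ¬ Sat G e φ := Iff.rfl

theorem sat_and {φ ψ : Fml} : Sat G e (and φ ψ) ↔ Sat G e φ ∧ Sat G e ψ := Iff.rfl

theorem sat_ex {v : Fin 8} {φ : Fml} :
    Sat G e (ex v φ) ↔ ∃ i, Sat G (Function.update e v (some i)) φ := Iff.rfl

theorem sat_or {φ ψ : Fml} : Sat G e (or φ ψ) ↔ Sat G e φ ∨ Sat G e ψ := by
  simp only [or, Sat]; tauto

theorem sat_imp {φ ψ : Fml} : Sat G e (imp φ ψ) ↔ (Sat G e φ → Sat G e ψ) := by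
  simp only [imp, Sat]; tauto

theorem sat_iff {φ ψ : Fml} : Sat G e (iff φ ψ) ↔ (Sat G e φ ↔ Sat G e ψ) := by
  simp only [iff, Sat, sat_imp]; tauto

theorem sat_all {v : Fin 8} {φ : Fml} :
    Sat G e (all v φ) ↔ ∀ i, Sat G (Function.update e v (some i)) φ := by
  simp [all, Sat]

section

variable {u v w : Fin 8} {i j k : Fin G.n} (hu : e u = some i) (hv : e v = some j)
  (hw : e w = some k)

include hu hv

theorem sat_lt : Sat G e (lt u v) ↔ i < j := by
  simp [Sat, hu, hv]

theorem sat_eq : Sat G e (eq u v) ↔ i = j := by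
  simp only [eq, Sat, hu, hv, Option.some.injEq, exists_and_left, exists_eq_left', not_lt]
  exact ⟨fun h => le_antisymm h.2 h.1, fun h => h ▸ ⟨le_rfl, le_rfl⟩⟩

theorem sat_near : Sat G e (near u v) ↔ G.graph.Near i j := by
  rw [near, sat_or, sat_eq hu hv]
  simp [Sat, hu, hv, SimpleGraph.Near]

include hw in
theorem sat_common : Sat G e (common u v w) ↔ G.graph.Common i j k := by
  rw [common, Sat, sat_near hu hw, sat_near hv hw]
  rfl

/-- The formula binds the variables 6 and 7, so the free ones must be smaller. For the same reason
`canonical`, which also binds 4 and 5, requires free variables below 4. -/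
theorem sat_generates (hu6 : u < 6) (hv6 : v < 6) :
    Sat G e (generates u v) ↔ G.graph.Generates i j := by
  have hu' : ∀ x : Option (Fin G.n), Function.update e 6 x u = some i := fun x => by
    rw [Function.update_of_ne (by omega), hu]
  have hv' : ∀ x : Option (Fin G.n), Function.update e 6 x v = some j := fun x => by
    rw [Function.update_of_ne (by omega), hv]
  have hu'' : ∀ x y : Option (Fin G.n),
      Function.update (Function.update e 6 x) 7 y u = some i := fun x y => by
    rw [Function.update_of_ne (by omega), hu']
  have hv'' : ∀ x y : Option (Fin G.n),
      Function.update (Function.update e 6 x) 7 y v = some j := fun x y => by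
    rw [Function.update_of_ne (by omega), hv']
  have h6 : ∀ x y : Option (Fin G.n),
      Function.update (Function.update e 6 x) 7 y 6 = x := fun x y => by simp
  have h7 : ∀ x y : Option (Fin G.n),
      Function.update (Function.update e 6 x) 7 y 7 = y := fun x y => by simp
  simp only [generates, Sat, sat_near hu hv, sat_all, sat_imp,
    sat_common (hu'' _ _) (hv'' _ _) (h6 _ _), sat_common (hu'' _ _) (hv'' _ _) (h7 _ _),
    sat_near (h6 _ _) (h7 _ _), SimpleGraph.Generates]

theorem sat_canonical (hu4 : u < 4) (hv4 : v < 4) :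
    Sat G e (canonical u v) ↔ G.graph.Canonical i j := by
  have hu' : ∀ x y : Option (Fin G.n),
      Function.update (Function.update e 4 x) 5 y u = some i := fun x y => by
    rw [Function.update_of_ne (by omega), Function.update_of_ne (by omega), hu]
  have hv' : ∀ x y : Option (Fin G.n),
      Function.update (Function.update e 4 x) 5 y v = some j := fun x y => by
    rw [Function.update_of_ne (by omega), Function.update_of_ne (by omega), hv]
  have hu'' : ∀ x y z : Option (Fin G.n),
      Function.update (Function.update (Function.update e 4 x) 5 y) 6 z u = some i :=
    fun x y z => by rw [Function.update_of_ne (by omega), hu']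
  have hv'' : ∀ x y z : Option (Fin G.n),
      Function.update (Function.update (Function.update e 4 x) 5 y) 6 z v = some j :=
    fun x y z => by rw [Function.update_of_ne (by omega), hv']
  have h4 : ∀ x y : Option (Fin G.n),
      Function.update (Function.update e 4 x) 5 y 4 = x := fun x y => by simp
  have h5 : ∀ x y : Option (Fin G.n),
      Function.update (Function.update e 4 x) 5 y 5 = y := fun x y => by simp
  have h4' : ∀ x y z : Option (Fin G.n),
      Function.update (Function.update (Function.update e 4 x) 5 y) 6 z 4 = x :=
    fun x y z => by simp
  have h5' : ∀ x y z : Option (Fin G.n),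
      Function.update (Function.update (Function.update e 4 x) 5 y) 6 z 5 = y :=
    fun x y z => by simp
  have h6' : ∀ x y z : Option (Fin G.n),
      Function.update (Function.update (Function.update e 4 x) 5 y) 6 z 6 = z :=
    fun x y z => by simp
  simp only [canonical, sat_not, sat_and, sat_ex, sat_or,
    sat_generates hu hv (show u < 6 by omega) (show v < 6 by omega), sat_lt (h4 _ _) (hu' _ _), sat_eq (h4 _ _) (hu' _ _),
    sat_lt (h5 _ _) (hv' _ _), sat_generates (h4 _ _) (h5 _ _) (by decide) (by decide), sat_all,
    sat_iff, sat_common (h4' _ _ _) (h5' _ _ _) (h6' _ _ _),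
    sat_common (hu'' _ _ _) (hv'' _ _ _) (h6' _ _ _), SimpleGraph.Canonical]

theorem sat_firstFar (hu4 : u < 4) (hv4 : v < 4) :
    Sat G e (firstFar u v) ↔ G.graph.FirstFar i j := by
  have hu' : ∀ x : Option (Fin G.n), Function.update e 6 x u = some i := fun x => by
    rw [Function.update_of_ne (by omega), hu]
  have hv' : ∀ x : Option (Fin G.n), Function.update e 6 x v = some j := fun x => by
    rw [Function.update_of_ne (by omega), hv]
  have h6 : ∀ x : Option (Fin G.n), Function.update e 6 x 6 = x := fun x => by simp
  simp only [firstFar, sat_not, sat_and, sat_ex, sat_near hu hv, sat_lt (h6 _) (hv' _), sat_near (hu' _) (h6 _),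
    SimpleGraph.FirstFar]

theorem sat_isSkeletonVertex (hu4 : u < 4) (hv4 : v < 4) :
    Sat G e (isSkeletonVertex u v) ↔ G.graph.IsSkeletonVertex (i, j) := by
  rw [isSkeletonVertex, sat_or, sat_canonical hu hv hu4 hv4, sat_firstFar hu hv hu4 hv4]
  rfl

end

theorem sat_skeletonAdj (p q : Fin G.n × Fin G.n) :
    Sat G (envQuad p q) skeletonAdj ↔ G.graph.pairGraph.Adj p q := by
  have h0 : envQuad p q 0 = some p.1 := by simp [envQuad, envPair]
  have h1 : envQuad p q 1 = some p.2 := by simp [envQuad, envPair]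
  have h2 : envQuad p q 2 = some q.1 := by simp [envQuad]
  have h3 : envQuad p q 3 = some q.2 := by simp [envQuad]
  simp only [skeletonAdj, sat_or, Sat, sat_near h0 h1, sat_near h2 h3, sat_eq h0 h2,
    sat_eq h1 h3, sat_common h0 h1 h2, sat_common h2 h3 h0, SimpleGraph.pairGraph, ne_eq,
    Prod.ext_iff]

theorem sat_covered :
    Sat G (fun _ => none) covered ↔ Nonempty (Fin G.n) ∧ G.graph.Covered := by
  have h00 : ∀ x : Fin G.n, Function.update (fun _ => none : Env G.n) 0 (some x) 0 = some x :=
    fun x => by simp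
  have h0 : ∀ x y : Fin G.n, envPair (x, y) 0 = some x := fun x y => by simp [envPair]
  have h1 : ∀ x y : Fin G.n, envPair (x, y) 1 = some y := fun x y => by simp [envPair]
  have k0 : ∀ x y z w : Fin G.n, envQuad (x, y) (z, w) 0 = some x := fun x y z w => by
    simp [envQuad, envPair]
  have k1 : ∀ x y z w : Fin G.n, envQuad (x, y) (z, w) 1 = some y := fun x y z w => by
    simp [envQuad, envPair]
  have k2 : ∀ x y z w : Fin G.n, envQuad (x, y) (z, w) 2 = some z := fun x y z w => by
    simp [envQuad]
  have k3 : ∀ x y z w : Fin G.n, envQuad (x, y) (z, w) 3 = some w := fun x y z w => by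
    simp [envQuad]
  rw [covered, Sat]
  refine and_congr ?_ ?_
  · simp only [Sat, h00]
    exact ⟨fun ⟨i, _⟩ => ⟨i⟩, fun ⟨i⟩ => ⟨i, by simp⟩⟩
  · simp only [sat_all, sat_imp, Sat]
    refine forall_congr' fun x => forall_congr' fun y => imp_congr (sat_near (h0 x y) (h1 x y))
      (exists_congr fun z => exists_congr fun w => and_congr
        (sat_generates (k2 x y z w) (k3 x y z w) (by decide) (by decide))
        (and_congr (sat_common (k2 x y z w) (k3 x y z w) (k0 x y z w))
          (sat_common (k2 x y z w) (k3 x y z w) (k1 x y z w))))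

theorem admissible_covered : covered.Admissible ∅ := by
  simp [covered, generates, common, near, eq, or, imp, all, Admissible]

theorem admissible_isSkeletonVertex : (isSkeletonVertex 0 1).Admissible {0, 1} := by
  simp [isSkeletonVertex, canonical, firstFar, generates, common, near, eq, or, imp, iff, all,
    Admissible]

theorem admissible_isSkeletonVertex' :
    (isSkeletonVertex 2 3).Admissible {0, 1, 2, 3} := by
  simp [isSkeletonVertex, canonical, firstFar, generates, common, near, eq, or, imp, iff, all,
    Admissible]

theorem admissible_skeletonAdj : skeletonAdj.Admissible {0, 1, 2, 3} := by
  simp [skeletonAdj, common, near, eq, or, Admissible]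

end StackProg.Fml

/-! ### The reduction and its correctness. -/

namespace FinGraph

open StackProg StackProg.Fml

/-- The skeleton of a graph, with its vertices numbered in lexicographic order. -/
noncomputable def skeletonGraph (G : FinGraph) : FinGraph where
  n := (pairs (isSkeletonVertex 0 1) G).length
  graph := G.graph.pairGraph.comap (pairs (isSkeletonVertex 0 1) G).get

theorem encode_skeletonGraph (G : FinGraph) :
    G.skeletonGraph.encode = matrixWord (isSkeletonVertex 0 1) skeletonAdj G := by
  classical
  have h := List.map_get_finRange (pairs (isSkeletonVertex 0 1) G)
  have e : matrixWord (isSkeletonVertex 0 1) skeletonAdj G =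
      (((List.finRange (pairs (isSkeletonVertex 0 1) G).length).map
        (pairs (isSkeletonVertex 0 1) G).get).flatMap fun p =>
      (((List.finRange (pairs (isSkeletonVertex 0 1) G).length).map
        (pairs (isSkeletonVertex 0 1) G).get).map fun q =>
          some (decide (Sat G (envQuad p q) skeletonAdj))) ++ [none]) := by
    rw [h]
    rfl
  rw [e, List.flatMap_map]
  simp only [List.map_map, Function.comp_def, sat_skeletonAdj]
  rfl

theorem mem_pairs_isSkeletonVertex {G : FinGraph} {p : Fin G.n × Fin G.n} :
    p ∈ pairs (isSkeletonVertex 0 1) G ↔ G.graph.IsSkeletonVertex p := by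
  have h0 : envPair p 0 = some p.1 := by simp [envPair]
  have h1 : envPair p 1 = some p.2 := by simp [envPair]
  obtain ⟨i, j⟩ := p
  simp [pairs, sat_isSkeletonVertex h0 h1]

theorem nodup_pairs (D : Fml) (G : FinGraph) : (pairs D G).Nodup :=
  ((List.nodup_finRange _).product (List.nodup_finRange _)).filter _

/-- The graph `skeletonGraph` is the skeleton. -/
noncomputable def skeletonGraphIso (G : FinGraph) : G.skeletonGraph.graph ≃g G.graph.skeleton where
  toEquiv := by
    classical
    exact ((nodup_pairs (isSkeletonVertex 0 1) G).getEquiv _).trans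
      (Equiv.subtypeEquivRight fun _ => mem_pairs_isSkeletonVertex)
  map_rel_iff' := Iff.rfl

/-- Two disjoint edges. -/
def twoEdges : FinGraph where
  n := 4
  graph := SimpleGraph.fromRel fun i j => (i = 0 ∧ j = 1) ∨ (i = 2 ∧ j = 3)

/-- Each edge needs an endpoint in the clique, but endpoints of different edges are not adjacent. -/
theorem not_isSplitGraph_twoEdges : ¬ twoEdges.graph.IsSplitGraph := by
  rintro ⟨C, hC, hI⟩
  have h1 : ∀ i j : Fin 4, i ∈ C → j ∈ C → i ≠ j → twoEdges.graph.Adj i j :=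
    fun i j hi hj hij => hC hi hj hij
  have h2 : ∀ i j : Fin 4, i ∉ C → j ∉ C → i ≠ j → ¬ twoEdges.graph.Adj i j :=
    fun i j hi hj hij => hI hi hj hij
  have a := h2 0 1
  have b := h2 2 3
  have c := h1 0 2
  have d := h1 0 3
  have e := h1 1 2
  have f := h1 1 3
  simp [twoEdges] at a b c d e f
  tauto

open Classical in
/-- The skeleton of a graph, when the graph is covered and the skeleton is not larger than the
graph, and a graph that is not split otherwise. -/
noncomputable def reduce (G : FinGraph) : FinGraph :=
  if (Nonempty (Fin G.n) ∧ G.graph.Covered) ∧ G.skeletonGraph.n ≤ G.n then G.skeletonGraph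
  else twoEdges

/-- The constant is the length 4 · 5 of the code of `twoEdges`. -/
theorem length_encode_reduce (G : FinGraph) :
    G.reduce.encode.length ≤ G.encode.length + 20 := by
  unfold reduce
  split_ifs with h
  · rw [length_encode, length_encode]
    have := Nat.mul_le_mul h.2 (Nat.add_le_add_right h.2 1)
    omega
  · rw [length_encode twoEdges]
    simp [twoEdges]

/-- A program that computes the code of `reduce`. -/
noncomputable def reduceProg : Prog :=
  interpret covered (isSkeletonVertex 0 1) (isSkeletonVertex 2 3) skeletonAdj twoEdges.encode

theorem exec_reduceProg : ∃ p : Polynomial ℕ, ∀ G : FinGraph, ∃ f, Exec reduceProg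
    ⟨false, Function.update (fun _ => []) (Sum.inl .mat) G.encode⟩
    ⟨f, Function.update (fun _ => []) (Sum.inl .out) G.reduce.encode.reverse⟩
    (p.eval G.encode.length) := by
  obtain ⟨p, hp⟩ := exec_interpret admissible_covered admissible_isSkeletonVertex
    admissible_isSkeletonVertex' admissible_skeletonAdj (fun G x y => by
      rw [sat_isSkeletonVertex (i := y.1) (j := y.2) (by simp [envQuad]) (by simp [envQuad])
        (by decide) (by decide), sat_isSkeletonVertex (i := y.1) (j := y.2) (by simp [envPair])
        (by simp [envPair]) (by decide) (by decide)]) twoEdges.encode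
  refine ⟨p, fun G => ?_⟩
  obtain ⟨f, hf⟩ := hp G
  refine ⟨f, ?_⟩
  classical
  have e : G.reduce.encode = if Sat G (fun _ => none) covered ∧
      (pairs (isSkeletonVertex 0 1) G).length ≤ G.n then
      matrixWord (isSkeletonVertex 0 1) skeletonAdj G else twoEdges.encode := by
    rw [← encode_skeletonGraph, reduce, apply_ite encode]
    exact if_congr (and_congr sat_covered.symm Iff.rfl) rfl rfl
  rw [e]
  exact hf

/-- Each application of `f` adds one vertex, universal in the square, so `Matches` persists. When
the vertex numbers agree it yields an isomorphism. -/
theorem exists_square_of_matches {𝒢 : Set FinGraph} (hsimple : IsSimpleClass 𝒢) (G : FinGraph)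
    (F : FinGraph) (hF : F ∈ 𝒢) (hc : F.graph.Connected) (hm : G.graph.Matches F.graph.square)
    (hn : F.n ≤ G.n) : ∃ H ∈ 𝒢, H.graph.Connected ∧ Nonempty (G.graph ≃g H.graph.square) := by
  obtain ⟨f, hf⟩ := hsimple
  obtain ⟨k, hk⟩ := Nat.exists_eq_add_of_le hn
  clear hn
  induction k generalizing F with
  | zero => exact ⟨F, hF, hc, hm.nonempty_iso (by simpa using hk)⟩
  | succ k ih =>
    obtain ⟨hfF, ⟨φ⟩⟩ := hf F hF hc
    have hcard : (f F).n = F.n + 1 := by simpa using Fintype.card_congr φ.toEquiv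
    refine ih (f F) hfF ?_ (hm.join.trans_iso φ.symm) (by omega)
    -- Connectedness of `f F` is not assumed but follows from its square being a join with one
    -- vertex.
    rw [← SimpleGraph.connected_square, φ.connected_iff]
    have h : ∀ v, (F.graph.square.join (⊤ : SimpleGraph (Fin 1))).Reachable (Sum.inr 0) v := by
      rintro (v | v)
      · exact SimpleGraph.Adj.reachable (by simp [SimpleGraph.join])
      · rw [Subsingleton.elim v 0]
    have : Nonempty (Fin F.n ⊕ Fin 1) := ⟨Sum.inr 0⟩
    exact ⟨fun u v => (h u).symm.trans (h v)⟩

theorem skeletonGraph_mem {𝒢 : Set FinGraph} (hsplit : ∀ H ∈ 𝒢, H.graph.IsSplitGraph)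
    (hsun : ∀ H ∈ 𝒢, H.graph.IsThreeSunFree) (hher : Hereditary 𝒢) {G : FinGraph}
    (hc : G.graph.Connected) (hG : HasSquareRootIn 𝒢 G) :
    G.graph.Covered ∧ G.skeletonGraph.n ≤ G.n ∧ G.skeletonGraph ∈ 𝒢 := by
  obtain ⟨H, hH, ⟨ψ⟩⟩ := hG
  -- Pulling the root back to the vertices of `G` makes its square equal to `G`, so the order used
  -- for the skeleton is the same on both sides.
  let F : FinGraph := ⟨G.n, H.graph.comap ψ⟩
  let φ : F.graph ≃g H.graph := ⟨ψ.toEquiv, Iff.rfl⟩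
  have hF : F ∈ 𝒢 := hher F H ⟨φ.toEmbedding⟩ hH
  have e : G.graph = F.graph.square := by
    ext u v
    exact ψ.map_adj_iff.symm.trans φ.square.map_adj_iff
  have hFc : F.graph.Connected := SimpleGraph.connected_square.1 (e ▸ hc)
  have hs : G.graph.skeleton ⊴ F.graph := by
    rw [e]
    exact SimpleGraph.skeleton_isIndContained (hsplit F hF) (hsun F hF) hFc
  obtain ⟨ι⟩ := hs
  let κ := ι.comp G.skeletonGraphIso.toEmbedding
  refine ⟨?_, by simpa using Fintype.card_le_of_injective κ κ.injective, hher _ F ⟨κ⟩ hF⟩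
  rw [e]
  exact SimpleGraph.covered_square (hsplit F hF) (hsun F hF) hFc

/-- If the test fails, a root is impossible, and `twoEdges` is outside every class of split graphs.
If it succeeds, membership of the skeleton decides. -/
theorem reduce_mem_iff {𝒢 : Set FinGraph} (hsplit : ∀ H ∈ 𝒢, H.graph.IsSplitGraph)
    (hsun : ∀ H ∈ 𝒢, H.graph.IsThreeSunFree) (hher : Hereditary 𝒢) (hsimple : IsSimpleClass 𝒢)
    (G : FinGraph) : G.reduce ∈ 𝒢 ↔ G.graph.Connected ∧ HasSquareRootIn 𝒢 G := by
  unfold reduce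
  split_ifs with h
  · obtain ⟨⟨hne, hcov⟩, hn⟩ := h
    let φ := G.skeletonGraphIso
    refine ⟨fun hmem => ?_, fun ⟨hc, hG⟩ => (skeletonGraph_mem hsplit hsun hher hc hG).2.2⟩
    obtain ⟨H, hH, hc, ⟨ψ⟩⟩ := exists_square_of_matches hsimple G G.skeletonGraph hmem
      (φ.connected_iff.2 hcov.connected_skeleton)
      (hcov.matches_skeleton.trans_iso φ.symm.square) hn
    exact ⟨ψ.connected_iff.2 (SimpleGraph.connected_square.2 hc), H, hH, ⟨ψ⟩⟩
  · refine ⟨fun hmem => absurd (hsplit _ hmem) not_isSplitGraph_twoEdges, fun ⟨hc, hG⟩ => ?_⟩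
    obtain ⟨h1, h2, -⟩ := skeletonGraph_mem hsplit hsun hher hc hG
    exact absurd ⟨⟨hc.nonempty, h1⟩, h2⟩ h

end FinGraph

theorem theorem9 (𝒢 : Set FinGraph)
    (hsplit : ∀ H ∈ 𝒢, H.graph.IsSplitGraph)
    (hsun : ∀ H ∈ 𝒢, H.graph.IsThreeSunFree)
    (hher : FinGraph.Hereditary 𝒢)
    (hsimple : FinGraph.IsSimpleClass 𝒢)
    (hrec : FinGraph.PolyTimeRecognizable 𝒢) :
    FinGraph.PolyTimeRecognizable
      {G : FinGraph | G.graph.Connected ∧ FinGraph.HasSquareRootIn 𝒢 G} := by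
  obtain ⟨f, hf, ⟨hg⟩⟩ := hrec
  obtain ⟨p, hp⟩ := FinGraph.exec_reduceProg
  refine ⟨f ∘ FinGraph.reduce, fun G => ?_, ?_⟩
  · exact (hf _).trans (FinGraph.reduce_mem_iff hsplit hsun hher hsimple G)
  · exact StackProg.polyTime_comp hg FinGraph.reduce FinGraph.reduceProg (Sum.inl .mat)
      (Sum.inl .out) p (Polynomial.X + 20) hp fun G => by
        simpa using G.length_encode_reduce
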